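/- Graph Probing. An instance consists of a simple undirected graph $G=(V,E)$ on $V=\{1,\dots,n\}$, rational probabilities $p_v\in[0,1]$ $(v\in V)$, and an integer $k$ with $1\le k\le |E|$. The hidden variables $Y_v\in\{0,1\}$, $v\in V$, are independent with $\Pr(Y_v=1)=p_v$, and an edge $e=uv$ is active if $X_e:=Y_u\vee Y_v=1$. Only edges can be probed; probing $e$ reveals $X_e$ and costs $1$. An adaptive policy chooses each next edge to probe depending on the outcomes of the earlier probes, and it may stop only when it has found $k$ different active edges or has probed all edges of $G$. Let $\mathrm{OPT}(G,p,k)$ be the minimum, over all adaptive policies, of the expected number of probes. There is a deterministic adaptive algorithm which, given an instance (with all numbers written in binary), probes edges one at a time, runs in time polynomial in the length of the input for every outcome of the $Y_v$, always stops having found $k$ different active edges or having probed all edges, and makes an expected number of probes of at most $$8\,(1+\log_2 k)\cdot \mathrm{OPT}(G,p,k).$$ In particular, Graph Probing has a polynomial-time adaptive $O(\log k)$-approximation relative to the optimal adaptive policy. -/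

import Mathlib

namespace GraphProbing

/-! ### A programming language with a step count

Programs compute on binary trees whose leaves are natural numbers written in binary.  They are
sequential WHILE programs, which may in addition ask to probe an element.  Every elementary
operation is charged at least for the number of bits it reads and writes (logarithmic cost), so
that a run of cost `t` is simulated by a multitape Turing machine in time polynomial in `t`, and
conversely. -/

/-- Binary trees with natural numbers at the leaves. -/
inductive Data where
  | num (m : ℕ)
  | pair (a b : Data)

namespace Data

/-- Bit size, a leaf `m` being written in binary. -/
def size : Data → ℕ
  | num m => 1 + Nat.size m
  | pair a b => 1 + a.size + b.size

/-- A list as a right comb of pairs, closed by the leaf `0`. -/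
def ofList : List Data → Data
  | [] => num 0
  | a :: l => pair a (ofList l)

end Data

/-- Elementary operations. -/
inductive Op where
  | id | fst | snd | isNum | add | sub | mul | div | le

/-- Effect of an elementary operation; arithmetic acts on a pair of leaves, and the result is the
leaf `0` where an operation does not apply. -/
def Op.apply : Op → Data → Data
  | .id, x => x
  | .fst, .pair a _ => a
  | .snd, .pair _ b => b
  | .isNum, .num _ => .num 1
  | .add, .pair (.num a) (.num b) => .num (a + b)
  | .sub, .pair (.num a) (.num b) => .num (a - b)
  | .mul, .pair (.num a) (.num b) => .num (a * b)
  | .div, .pair (.num a) (.num b) => .num (a / b)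
  | .le, .pair (.num a) (.num b) => .num (if a ≤ b then 1 else 0)
  | _, _ => .num 0

/-- Programs. -/
inductive Prog where
  /-- return a constant -/
  | const (d : Data)
  /-- an elementary operation -/
  | op (o : Op)
  /-- first `f`, then `g` on its result -/
  | seq (f g : Prog)
  /-- run `f` and `g` on the same input and pair the results -/
  | pair (f g : Prog)
  /-- run `f` if the result of the test `c` is not the leaf `0`, otherwise run `g` -/
  | cond (c f g : Prog)
  /-- as long as the result of the test `c` is not the leaf `0`, replace the input by the result
  of `f` -/
  | loop (c f : Prog)
  /-- probe the element named by the input; the answer is the leaf `1` (active) or `0` (inactive) -/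
  | probe

/-- `Exec oracle A x y l t`: on input `x` the program `A` halts with output `y`, after having
probed the elements of `l` in this order, at total cost `t`.  The oracle tells which element a
datum names and whether this element is active; a program that tries to probe a datum which names
no element does not halt. -/
inductive Exec {ε : Type} (oracle : Data → Option (ε × Bool)) :
    Prog → Data → Data → List ε → ℕ → Prop
  | const (d x : Data) : Exec oracle (.const d) x d [] (1 + x.size + d.size)
  | op (o : Op) (x : Data) : Exec oracle (.op o) x (o.apply x) [] ((1 + x.size) ^ 2)
  | seq {f g : Prog} {x y z : Data} {l₁ l₂ : List ε} {t₁ t₂ : ℕ} :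
      Exec oracle f x y l₁ t₁ → Exec oracle g y z l₂ t₂ →
      Exec oracle (.seq f g) x z (l₁ ++ l₂) (1 + t₁ + t₂)
  | pair {f g : Prog} {x y z : Data} {l₁ l₂ : List ε} {t₁ t₂ : ℕ} :
      Exec oracle f x y l₁ t₁ → Exec oracle g x z l₂ t₂ →
      Exec oracle (.pair f g) x (.pair y z) (l₁ ++ l₂) (1 + x.size + t₁ + t₂)
  | cond_true {c f g : Prog} {x b y : Data} {l₁ l₂ : List ε} {t₁ t₂ : ℕ} :
      Exec oracle c x b l₁ t₁ → b ≠ .num 0 → Exec oracle f x y l₂ t₂ →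
      Exec oracle (.cond c f g) x y (l₁ ++ l₂) (1 + x.size + t₁ + t₂)
  | cond_false {c f g : Prog} {x y : Data} {l₁ l₂ : List ε} {t₁ t₂ : ℕ} :
      Exec oracle c x (.num 0) l₁ t₁ → Exec oracle g x y l₂ t₂ →
      Exec oracle (.cond c f g) x y (l₁ ++ l₂) (1 + x.size + t₁ + t₂)
  | loop_stop {c f : Prog} {x : Data} {l : List ε} {t : ℕ} :
      Exec oracle c x (.num 0) l t →
      Exec oracle (.loop c f) x x l (1 + x.size + t)
  | loop_step {c f : Prog} {x b y z : Data} {l₁ l₂ l₃ : List ε} {t₁ t₂ t₃ : ℕ} :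
      Exec oracle c x b l₁ t₁ → b ≠ .num 0 → Exec oracle f x y l₂ t₂ →
      Exec oracle (.loop c f) y z l₃ t₃ →
      Exec oracle (.loop c f) x z (l₁ ++ l₂ ++ l₃) (1 + x.size + t₁ + t₂ + t₃)
  | probe {x : Data} {e : ε} {b : Bool} : oracle x = some (e, b) →
      Exec oracle .probe x (.num b.toNat) [e] (1 + x.size)

/-- Programs are deterministic: input and answers determine the whole run. -/
theorem Exec.unique {ε : Type} {oracle : Data → Option (ε × Bool)} {A : Prog}
    {x y y' : Data} {l l' : List ε} {t t' : ℕ}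
    (h : Exec oracle A x y l t) (h' : Exec oracle A x y' l' t') : y = y' ∧ l = l' ∧ t = t' := by
  induction h generalizing y' l' t' with
  | const => cases h'; simp
  | op => cases h'; simp
  | seq _ _ ih₁ ih₂ =>
    cases h' with
    | seq a b =>
      obtain ⟨rfl, rfl, rfl⟩ := ih₁ a
      obtain ⟨rfl, rfl, rfl⟩ := ih₂ b
      simp
  | pair _ _ ih₁ ih₂ =>
    cases h' with
    | pair a b =>
      obtain ⟨rfl, rfl, rfl⟩ := ih₁ a
      obtain ⟨rfl, rfl, rfl⟩ := ih₂ b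
      simp
  | cond_true _ hb _ ih₁ ih₂ =>
    cases h' with
    | cond_true a _ b =>
      obtain ⟨rfl, rfl, rfl⟩ := ih₁ a
      obtain ⟨rfl, rfl, rfl⟩ := ih₂ b
      simp
    | cond_false a b => exact absurd (ih₁ a).1 hb
  | cond_false _ _ ih₁ ih₂ =>
    cases h' with
    | cond_true a hb b => exact absurd (ih₁ a).1.symm hb
    | cond_false a b =>
      obtain ⟨-, rfl, rfl⟩ := ih₁ a
      obtain ⟨rfl, rfl, rfl⟩ := ih₂ b
      simp
  | loop_stop _ ih =>
    cases h' with
    | loop_stop a =>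
      obtain ⟨-, rfl, rfl⟩ := ih a
      simp
    | loop_step a hb _ _ => exact absurd (ih a).1.symm hb
  | loop_step _ hb _ _ ih₁ ih₂ ih₃ =>
    cases h' with
    | loop_stop a => exact absurd (ih₁ a).1 hb
    | loop_step a _ b c =>
      obtain ⟨rfl, rfl, rfl⟩ := ih₁ a
      obtain ⟨rfl, rfl, rfl⟩ := ih₂ b
      obtain ⟨rfl, rfl, rfl⟩ := ih₃ c
      simp
  | probe ho =>
    cases h' with
    | probe ho' =>
      obtain ⟨rfl, rfl⟩ := Prod.mk.inj (Option.some.inj (ho.symm.trans ho'))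
      simp

/-! ### Graph Probing -/

/-- An input: a simple graph, rational activation probabilities of its vertices, and the number
of active edges to be found. -/
structure Input where
  n : ℕ
  G : SimpleGraph (Fin n)
  p : Fin n → ℚ
  p_nonneg : ∀ v, 0 ≤ p v
  p_le_one : ∀ v, p v ≤ 1
  k : ℕ
  one_le_k : 1 ≤ k
  k_le : k ≤ G.edgeSet.ncard

/-- An adaptive policy: halt, or probe an element and continue according to its state. -/
inductive Policy (ε : Type) where
  | halt
  | probe (e : ε) (ifInactive ifActive : Policy ε)

/-- The elements that a policy probes, in order, when `X` gives the states of the elements. -/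
def Policy.probes {ε : Type} : Policy ε → (ε → Bool) → List ε
  | .halt, _ => []
  | .probe e π₀ π₁, X => e :: (if X e = true then π₁.probes X else π₀.probes X)

namespace Input

/-- The elements that can be probed: the edges of the graph. -/
abbrev Edge (I : Input) : Type := I.G.edgeSet

/-- An outcome of the (hidden) vertex variables. -/
abbrev Outcome (I : Input) : Type := Fin I.n → Bool

/-- The edge variable `X_{uv} = Y_u ∨ Y_v`. -/
def X (I : Input) (Y : I.Outcome) (e : I.Edge) : Bool :=
  Sym2.lift ⟨fun u v => Y u || Y v, fun _ _ => Bool.or_comm _ _⟩ (e : Sym2 (Fin I.n))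

/-- The expectation of `f Y` for independent `Y v` with `Pr(Y v = 1) = p v`. -/
noncomputable def expect (I : Input) (f : I.Outcome → ℝ) : ℝ :=
  ∑ Y : I.Outcome, (∏ v, if Y v = true then (I.p v : ℝ) else 1 - (I.p v : ℝ)) * f Y

/-- Under the outcome `Y`, probing the edges in `l` finds `k` different active edges, or `l`
contains all edges. -/
def Done (I : Input) (Y : I.Outcome) (l : List I.Edge) : Prop :=
  I.k ≤ {e : I.Edge | e ∈ l ∧ I.X Y e = true}.ncard ∨ ∀ e : I.Edge, e ∈ l

/-- A policy solves the instance if it halts only when `k` active edges have been found or all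
edges have been probed. -/
def IsFeasible (I : Input) (π : Policy I.Edge) : Prop :=
  ∀ Y : I.Outcome, I.Done Y (π.probes (I.X Y))

/-- The expected number of probes of a policy. -/
noncomputable def expectedCost (I : Input) (π : Policy I.Edge) : ℝ :=
  I.expect fun Y => ((π.probes (I.X Y)).length : ℝ)

open Classical in
/-- The encoding of an input: the list of the vertex probabilities (numerators and denominators),
the list of the edges `uv` with `u < v`, and `k`. -/
noncomputable def encode (I : Input) : Data :=
  .pair
    (Data.ofList ((List.finRange I.n).map fun v =>
      .pair (.num (I.p v).num.toNat) (.num (I.p v).den)))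
    (.pair
      (Data.ofList
        (((List.finRange I.n ×ˢ List.finRange I.n).filter
            fun e => decide (e.1 < e.2 ∧ I.G.Adj e.1 e.2)).map
          fun e => .pair (.num e.1) (.num e.2)))
      (.num I.k))

open Classical in
/-- The answers to probes under the outcome `Y`: the pair `(u, v)`, for adjacent `u` and `v`, names
the edge `uv`, whose state is `X_{uv}`; nothing else can be probed. -/
noncomputable def oracle (I : Input) (Y : I.Outcome) : Data → Option (I.Edge × Bool)
  | .pair (.num u) (.num v) =>
    if h : ∃ (hu : u < I.n) (hv : v < I.n), I.G.Adj ⟨u, hu⟩ ⟨v, hv⟩ then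
      let e : I.Edge := ⟨s(⟨u, h.choose⟩, ⟨v, h.choose_spec.choose⟩), h.choose_spec.choose_spec⟩
      some (e, I.X Y e)
    else none
  | _ => none

end Input

end GraphProbing

/-!
The algorithm grows clusters of active edges.  Call a vertex *hot* if an edge at it was found
active but none was found inactive, and *fresh* if no edge at it has been probed.  As long as some
unprobed edge has a hot endpoint, such an edge is probed.  Otherwise the algorithm probes a
*seed*: an edge with an endpoint `v` for which `p v * min need (deg v)` is largest, where `need`
is the number of active edges still to be found, `deg` counts unprobed edges, and vertices with an
inactive edge count as having probability zero.  Posterior probabilities, which would be hard to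
compute, are never used.

**Probes that are not seeds.**  Such a probe finds an active edge, or it is inactive and removes a
hot vertex.  Since hot vertices are created by active edges, there are at most `2 * (k - 1)` more
probes than seeds (`sum_running_le`), and every feasible policy makes at least `k` probes.

**Seeds.**  When a seed is chosen, no unprobed edge has a hot endpoint, and nothing is known about
fresh vertices, so that their values are still independent with the original probabilities
(`run_congr`, `Input.expect_ite_of_invariant`).  If the leading vertex has value `1`, then all of
its unprobed edges are active and are probed before the next seed, unless enough active edges are
found first; hence the expected gain of the seed is at least `p v * min need (deg v)`, and along
every run the gains relative to `need` add up to at most the harmonic number `H` of `k`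
(`sum_gain_le`).  On the other hand, let `π` be any feasible policy.  When `π` has found `k`
active edges within `τ` probes, the edges that the algorithm still needs are incident to fresh
vertices of value `1` among the at most `2 * τ` vertices that `π` has touched (`need_le_sum`).
Whether `π` touches a vertex does not depend on the value of this vertex (`Input.touches_flip`),
so by the greedy choice the expected relative gain of the seed is at least `1 / (2 * τ)` times the
probability that `π` has found `k` active edges within `τ` probes
(`Input.half_mul_expect_finds_le`).

Apply this with `τ = (c + 1) / L` to the seed that comes after `c` others, multiply by `c + 1`,
and sum over the seeds.  With `N` the number of seeds and `C` the number of probes of `π`, this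
gives `L / 2 * (E[N] - L * E[C]) ≤ H * E[N]`, and `L = 4 * H` yields `E[N] ≤ 8 * H * E[C]`
(`Input.expect_seeds_le`).  Finally `H ≤ 1 + log k`, and the difference between `log` and `log₂`
pays for the probes that are not seeds.

**Running time.**  `PolyTime` is a class of functions between encoded types that is closed under
the constructions used by the algorithm, among them folds over lists with intermediate results of
polynomial size (`PolyTime.foldl`).  The choice of the next edge belongs to this class, and the
size of the state never grows, so that the main loop is polynomial as well (`exists_loop`).
-/

namespace GraphProbing

open Polynomial

/-! ### Functions computed in polynomial time without probes -/

theorem Data.one_le_size (x : Data) : 1 ≤ x.size := by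
  cases x <;> simp only [Data.size] <;> omega

theorem nat_size_mul_le (a b : ℕ) : Nat.size (a * b) ≤ Nat.size a + Nat.size b := by
  rw [Nat.size_le, pow_add]
  exact Nat.mul_lt_mul'' (Nat.lt_size_self a) (Nat.lt_size_self b)

theorem nat_size_add_le (a b : ℕ) : Nat.size (a + b) ≤ Nat.size a + Nat.size b + 1 := by
  rw [Nat.size_le]
  have ha := Nat.lt_size_self a
  have hb := Nat.lt_size_self b
  have h1 : 2 ^ a.size ≤ 2 ^ (a.size + b.size) := Nat.pow_le_pow_right (by norm_num) (by omega)
  have h2 : 2 ^ b.size ≤ 2 ^ (a.size + b.size) := Nat.pow_le_pow_right (by norm_num) (by omega)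
  rw [pow_succ]
  omega

theorem nat_size_le_self (a : ℕ) : Nat.size a ≤ a :=
  Nat.size_le.2 Nat.lt_two_pow_self

theorem Op.size_apply_le (o : Op) (x : Data) : (o.apply x).size ≤ x.size + 1 := by
  have hx := x.one_le_size
  have h1 : Nat.size 1 = 1 := by decide
  unfold Op.apply
  split <;> simp only [Data.size, Nat.size_zero, h1] at * <;> try omega
  · rename_i a b
    have := nat_size_add_le a b
    omega
  · rename_i a b
    have := Nat.size_le_size (Nat.sub_le a b)
    omega
  · rename_i a b
    have := nat_size_mul_le a b
    omega
  · rename_i a b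
    have := Nat.size_le_size (Nat.div_le_self a b)
    omega
  · rename_i a b
    have : Nat.size (if a ≤ b then 1 else 0) ≤ 1 := by split <;> decide
    omega

/-- The cost of a run bounds the size of its output. -/
theorem Exec.size_le {ε : Type} {oracle : Data → Option (ε × Bool)} {A : Prog} {x y : Data}
    {l : List ε} {t : ℕ} (h : Exec oracle A x y l t) : y.size ≤ t := by
  induction h with
  | const d x => omega
  | op o x =>
    have := o.size_apply_le x
    nlinarith
  | seq _ _ _ ih => omega
  | pair _ _ ih₁ ih₂ => simp only [Data.size]; omega
  | cond_true _ _ _ _ ih => omega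
  | cond_false _ _ _ ih => omega
  | loop_stop _ _ => omega
  | loop_step _ _ _ _ _ ih => omega
  | @probe x e b _ =>
    have := x.one_le_size
    have h1 : Nat.size 1 = 1 := by decide
    cases b <;> simp [Data.size, h1]; omega

theorem eval_mono (T : ℕ[X]) {a b : ℕ} (h : a ≤ b) : T.eval a ≤ T.eval b := by
  simp only [Polynomial.eval_eq_sum, Polynomial.sum]
  gcongr

/-- Types whose elements are given to programs as data. -/
class Enc (α : Type) where
  enc : α → Data

open Enc

instance : Enc ℕ := ⟨Data.num⟩

instance {α β : Type} [Enc α] [Enc β] : Enc (α × β) := ⟨fun x => .pair (enc x.1) (enc x.2)⟩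

instance {α : Type} [Enc α] : Enc (List α) := ⟨fun l => Data.ofList (l.map enc)⟩

variable {α β γ : Type} [Enc α] [Enc β] [Enc γ]

/-- The bit size of the encoding. -/
def sz (a : α) : ℕ := (enc a).size

theorem sz_prod (a : α) (b : β) : sz (a, b) = 1 + sz a + sz b := rfl

theorem sz_nil : sz ([] : List α) = 1 := rfl

theorem sz_cons (a : α) (l : List α) : sz (a :: l) = 1 + sz a + sz l := rfl

theorem sz_nat_le (a : ℕ) : sz a ≤ 1 + a := by
  have := nat_size_le_self a
  change 1 + Nat.size a ≤ _
  omega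

theorem length_lt_sz (l : List α) : l.length < sz l := by
  induction l with
  | nil => simp [sz_nil]
  | cons a l ih => rw [sz_cons, List.length_cons]; omega

theorem sz_perm {l l' : List α} (h : l.Perm l') : sz l = sz l' := by
  induction h with
  | nil => rfl
  | cons x _ ih => rw [sz_cons, sz_cons, ih]
  | swap x y l => simp only [sz_cons]; omega
  | trans _ _ ih₁ ih₂ => exact ih₁.trans ih₂

theorem sz_append (l l' : List α) : sz (l ++ l') + 1 = sz l + sz l' := by
  induction l with
  | nil => rw [List.nil_append, sz_nil]; omega
  | cons a l ih => rw [List.cons_append, sz_cons, sz_cons]; omega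

theorem sz_prefix_le {l l' : List α} (h : l' <+: l) : sz l' ≤ sz l := by
  obtain ⟨r, rfl⟩ := h
  have := sz_append l' r
  have : 1 ≤ sz r := Data.one_le_size _
  omega

theorem sz_mem_le {l : List α} {a : α} (h : a ∈ l) : sz a ≤ sz l := by
  induction l with
  | nil => simp at h
  | cons b l ih =>
    rw [sz_cons]
    rcases List.mem_cons.1 h with rfl | h
    · omega
    · have := ih h; omega

/-- `f` is computed, without probes, by a program whose cost is polynomial in the size of the
encoded argument.  The cost must not depend on the oracle. -/
def PolyTime (f : α → β) : Prop :=
  ∃ (A : Prog) (T : ℕ[X]), ∀ a, ∃ t ≤ T.eval (sz a),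
    ∀ (ε : Type) (oracle : Data → Option (ε × Bool)), Exec oracle A (enc a) (enc (f a)) [] t

/-- `p` is decided in polynomial time, without probes. -/
def PolyTimePred (p : α → Prop) [DecidablePred p] : Prop := PolyTime fun a => if p a then 1 else 0

namespace PolyTime

theorem sz_le {f : α → β} (hf : PolyTime f) : ∃ S : ℕ[X], ∀ a, sz (f a) ≤ S.eval (sz a) := by
  obtain ⟨A, T, h⟩ := hf
  refine ⟨T, fun a => ?_⟩
  obtain ⟨t, ht, he⟩ := h a
  exact (he Unit fun _ => none).size_le.trans ht

theorem comp {g : β → γ} {f : α → β} (hg : PolyTime g) (hf : PolyTime f) :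
    PolyTime fun a => g (f a) := by
  obtain ⟨A, T, h⟩ := hf
  obtain ⟨B, S, h'⟩ := hg
  refine ⟨.seq A B, 1 + T + S.comp T, fun a => ?_⟩
  obtain ⟨t, ht, he⟩ := h a
  obtain ⟨t', ht', he'⟩ := h' (f a)
  have hs : sz (f a) ≤ T.eval (sz a) := (he Unit fun _ => none).size_le.trans ht
  refine ⟨1 + t + t', ?_, fun ε o => by simpa using (he ε o).seq (he' ε o)⟩
  have := eval_mono S hs
  simp only [eval_add, eval_one, eval_comp]
  omega

theorem pair {f : α → β} {g : α → γ} (hf : PolyTime f) (hg : PolyTime g) :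
    PolyTime fun a => (f a, g a) := by
  obtain ⟨A, T, h⟩ := hf
  obtain ⟨B, S, h'⟩ := hg
  refine ⟨.pair A B, 1 + X + T + S, fun a => ?_⟩
  obtain ⟨t, ht, he⟩ := h a
  obtain ⟨t', ht', he'⟩ := h' a
  refine ⟨1 + sz a + t + t', ?_, fun ε o => Exec.pair (l₁ := []) (l₂ := []) (he ε o) (he' ε o)⟩
  simp only [eval_add, eval_one, eval_X]
  omega

theorem const (b : β) : PolyTime fun _ : α => b := by
  refine ⟨.const (enc b), 1 + X + C (sz b), fun a => ⟨_, ?_, fun ε o => .const _ _⟩⟩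
  simp [sz]

theorem of_op (o : Op) {f : α → β} (h : ∀ a, o.apply (enc a) = enc (f a)) : PolyTime f := by
  refine ⟨.op o, (1 + X) ^ 2, fun a => ⟨(1 + (enc a).size) ^ 2, ?_, fun ε r => ?_⟩⟩
  · simp [sz]
  · rw [← h]; exact .op o _

theorem id : PolyTime fun a : α => a := of_op .id fun _ => rfl

theorem fst : PolyTime fun a : α × β => a.1 := of_op .fst fun _ => rfl

theorem snd : PolyTime fun a : α × β => a.2 := of_op .snd fun _ => rfl

theorem add {f g : α → ℕ} (hf : PolyTime f) (hg : PolyTime g) : PolyTime fun a => f a + g a :=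
  (of_op (f := fun x : ℕ × ℕ => x.1 + x.2) .add fun _ => rfl).comp (hf.pair hg)

theorem sub {f g : α → ℕ} (hf : PolyTime f) (hg : PolyTime g) : PolyTime fun a => f a - g a :=
  (of_op (f := fun x : ℕ × ℕ => x.1 - x.2) .sub fun _ => rfl).comp (hf.pair hg)

theorem mul {f g : α → ℕ} (hf : PolyTime f) (hg : PolyTime g) : PolyTime fun a => f a * g a :=
  (of_op (f := fun x : ℕ × ℕ => x.1 * x.2) .mul fun _ => rfl).comp (hf.pair hg)

theorem le {f g : α → ℕ} (hf : PolyTime f) (hg : PolyTime g) : PolyTimePred fun a => f a ≤ g a :=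
  (of_op (f := fun x : ℕ × ℕ => if x.1 ≤ x.2 then 1 else 0) .le fun _ => rfl).comp (hf.pair hg)

theorem ite {p : α → Prop} [DecidablePred p] {f g : α → β}
    (hp : PolyTimePred p) (hf : PolyTime f) (hg : PolyTime g) :
    PolyTime fun a => if p a then f a else g a := by
  obtain ⟨A, T, h⟩ := hf
  obtain ⟨B, S, h'⟩ := hg
  obtain ⟨D, R, h''⟩ := hp
  refine ⟨.cond D A B, 1 + X + R + T + S, fun a => ?_⟩
  obtain ⟨t, ht, he⟩ := h a
  obtain ⟨t', ht', he'⟩ := h' a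
  obtain ⟨t'', ht'', he''⟩ := h'' a
  by_cases hpa : p a
  · refine ⟨1 + sz a + t'' + t, ?_, fun ε o => ?_⟩
    · simp only [eval_add, eval_one, eval_X]; omega
    · have := he'' ε o
      simp only [if_pos hpa] at this ⊢
      exact Exec.cond_true (l₁ := []) (l₂ := []) this (by simp [enc]) (he ε o)
  · refine ⟨1 + sz a + t'' + t', ?_, fun ε o => ?_⟩
    · simp only [eval_add, eval_one, eval_X]; omega
    · have := he'' ε o
      simp only [if_neg hpa] at this ⊢
      exact Exec.cond_false (l₁ := []) (l₂ := []) this (he' ε o)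

end PolyTime

namespace PolyTimePred

theorem and {p q : α → Prop} [DecidablePred p] [DecidablePred q]
    (hp : PolyTimePred p) (hq : PolyTimePred q) :
    PolyTimePred fun a => p a ∧ q a := by
  have h := PolyTime.ite hp hq (PolyTime.const 0)
  unfold PolyTimePred
  convert h using 2 with a
  by_cases h1 : p a <;> by_cases h2 : q a <;> simp [h1, h2]

theorem not {p : α → Prop} [DecidablePred p] (hp : PolyTimePred p) :
    PolyTimePred fun a => ¬ p a := by
  have h := PolyTime.ite hp (PolyTime.const 0) (PolyTime.const 1)
  unfold PolyTimePred
  convert h using 2 with a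
  by_cases h1 : p a <;> simp [h1]

theorem or {p q : α → Prop} [DecidablePred p] [DecidablePred q]
    (hp : PolyTimePred p) (hq : PolyTimePred q) :
    PolyTimePred fun a => p a ∨ q a := by
  have h := PolyTime.ite hp (PolyTime.const 1) hq
  unfold PolyTimePred
  convert h using 2 with a
  by_cases h1 : p a <;> by_cases h2 : q a <;> simp [h1, h2]

end PolyTimePred

namespace PolyTime

theorem eq {f g : α → ℕ} (hf : PolyTime f) (hg : PolyTime g) : PolyTimePred fun a => f a = g a := by
  have h := (hf.le hg).and (hg.le hf)
  unfold PolyTimePred at h ⊢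
  convert h using 3 with a
  exact Nat.le_antisymm_iff

theorem cons {f : α → β} {g : α → List β} (hf : PolyTime f) (hg : PolyTime g) :
    PolyTime fun a => f a :: g a :=
  (of_op (f := fun x : β × List β => x.1 :: x.2) .id fun _ => rfl).comp (hf.pair hg)

theorem isEmpty {l : α → List γ} (hl : PolyTime l) : PolyTimePred fun a => l a = [] := by
  refine (of_op (f := fun x : List γ => if x = [] then 1 else 0) .isNum fun x => ?_).comp hl
  cases x <;> rfl

/-- Case distinction on a list. -/
theorem listCases {l : α → List γ} {f : α → β} {g : α → γ → List γ → β} (hl : PolyTime l)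
    (hf : PolyTime f)
    (hg : PolyTime fun x : α × γ × List γ => g x.1 x.2.1 x.2.2) :
    PolyTime fun a => match l a with
      | [] => f a
      | c :: r => g a c r := by
  obtain ⟨A, T, h⟩ := hf
  obtain ⟨B, S, h'⟩ := hg
  obtain ⟨D, R, h''⟩ := hl.isEmpty
  obtain ⟨F, Q, h₃⟩ := id.pair hl
  refine ⟨.cond D A (.seq F B), 2 + X + R + T + Q + S.comp Q, fun a => ?_⟩
  obtain ⟨t, ht, he⟩ := h a
  obtain ⟨t'', ht'', he''⟩ := h'' a
  obtain ⟨t₃, ht₃, he₃⟩ := h₃ a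
  rcases hla : l a with _ | ⟨c, r⟩
  · refine ⟨1 + sz a + t'' + t, ?_, fun ε o => ?_⟩
    · simp only [eval_add, eval_X, eval_ofNat]; omega
    · have := he'' ε o
      simp only [hla, if_true] at this
      simp only [hla]
      exact Exec.cond_true (l₁ := []) (l₂ := []) this (by simp [enc]) (he ε o)
  · obtain ⟨t', ht', he'⟩ := h' (a, c, r)
    have hs : sz (a, l a) ≤ Q.eval (sz a) := (he₃ Unit fun _ => none).size_le.trans ht₃
    refine ⟨1 + sz a + t'' + (1 + t₃ + t'), ?_, fun ε o => ?_⟩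
    · have h2 := eval_mono S hs
      rw [hla] at h2
      have h3 : sz (a, c, r) = sz (a, c :: r) := rfl
      rw [h3] at ht'
      simp only [eval_add, eval_X, eval_ofNat, eval_comp]
      omega
    · have h1 := he'' ε o
      have h2 := he₃ ε o
      simp only [hla, reduceCtorEq, if_false] at h1 h2
      simp only [hla]
      exact Exec.cond_false (l₁ := []) (l₂ := []) h1 (Exec.seq (l₁ := []) (l₂ := []) h2 (he' ε o))

/-- A fold over a list runs in polynomial time if its step does and if all intermediate values
have polynomial size. -/
theorem foldl {l : α → List γ} {f : α → β → γ → β} {init : α → β}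
    (hl : PolyTime l) (hi : PolyTime init)
    (hf : PolyTime fun x : γ × β × α => f x.2.2 x.2.1 x.1) {S : ℕ[X]}
    (hS : ∀ a, ∀ l', l' <+: l a → sz (l'.foldl (f a) (init a)) ≤ S.eval (sz a)) :
    PolyTime fun a => (l a).foldl (f a) (init a) := by
  have hstart : PolyTime fun a => (l a, init a, a) := hl.pair (hi.pair id)
  have htest : PolyTimePred fun x : List γ × β × α => ¬ x.1 = [] := (fst.isEmpty).not
  obtain ⟨D, R, hD⟩ := htest
  obtain ⟨F, Q, hF⟩ := hf
  obtain ⟨Ql, hQl⟩ := hl.sz_le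
  -- the body of the loop, on data of the form `((c, r), b, a)`
  let body : Prog := .pair (.seq (.op .fst) (.op .snd))
    (.pair (.seq (.pair (.seq (.op .fst) (.op .fst)) (.op .snd)) F) (.seq (.op .snd) (.op .snd)))
  -- a bound on the size of the loop states
  let W : ℕ[X] := 2 + Ql + S + X
  let K : ℕ[X] := 20 * (1 + W) ^ 2 + R.comp W + Q.comp W
  have hloop : ∀ (a : α) (r : List γ) (b : β) (l₀ : List γ), l₀ ++ r = l a →
      l₀.foldl (f a) (init a) = b →
      ∃ t ≤ (r.length + 1) * K.eval (sz a),
        ∀ (ε : Type) (oracle : Data → Option (ε × Bool)),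
          Exec oracle (.loop D body) (enc (r, b, a)) (enc (([] : List γ), r.foldl (f a) b, a))
            [] t := by
    intro a r
    induction r with
    | nil =>
      intro b l₀ h₀ hb
      obtain ⟨t, ht, he⟩ := hD (([] : List γ), b, a)
      have hsz : sz (([] : List γ), b, a) ≤ W.eval (sz a) := by
        have h1 := hS a l₀ ⟨[], h₀⟩
        have h2 : 1 ≤ sz (l a) := Data.one_le_size _
        have h3 := hQl a
        rw [hb] at h1
        simp only [sz_prod, sz_nil, W, eval_add, eval_X, eval_ofNat]
        omega
      refine ⟨1 + sz (([] : List γ), b, a) + t, ?_, fun ε o => ?_⟩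
      · have := eval_mono R hsz
        simp only [List.length_nil, K, eval_add, eval_mul, eval_pow, eval_one, eval_comp,
          eval_ofNat]
        nlinarith
      · have := he ε o
        simp only [not_true_eq_false, if_false] at this
        exact Exec.loop_stop this
    | cons c r ih =>
      intro b l₀ h₀ hb
      obtain ⟨t, ht, he⟩ := hD (c :: r, b, a)
      obtain ⟨t', ht', he'⟩ := hF (c, b, a)
      obtain ⟨t₃, ht₃, he₃⟩ := ih (f a b c) (l₀ ++ [c]) (by simpa using h₀) (by simp [hb])
      have hsz : sz (c :: r, b, a) ≤ W.eval (sz a) := by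
        have h1 := hS a l₀ ⟨_, h₀⟩
        have h2 := sz_append l₀ (c :: r)
        have h3 := hQl a
        have h4 : 1 ≤ sz l₀ := Data.one_le_size _
        rw [h₀] at h2
        rw [hb] at h1
        simp only [sz_prod, W, eval_add, eval_X, eval_ofNat]
        omega
      have hsz' : sz (c, b, a) ≤ W.eval (sz a) := by
        simp only [sz_prod, sz_cons] at hsz ⊢
        omega
      have hexec : ∃ t₂ ≤ 18 * (1 + sz (c :: r, b, a)) ^ 2 + t',
          ∀ (ε : Type) (oracle : Data → Option (ε × Bool)),
          Exec oracle body (enc (c :: r, b, a)) (enc (r, f a b c, a)) [] t₂ := by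
        refine ⟨_, ?_, fun ε o => Exec.pair (l₁ := []) (l₂ := [])
          (Exec.seq (l₁ := []) (l₂ := []) (.op _ _) (.op _ _))
          (Exec.pair (l₁ := []) (l₂ := []) (.seq (l₁ := []) (l₂ := []) (.pair (l₁ := []) (l₂ := [])
            (.seq (l₁ := []) (l₂ := []) (.op _ _) (.op _ _)) (.op _ _)) (he' ε o))
            (.seq (l₁ := []) (l₂ := []) (.op _ _) (.op _ _)))⟩
        have e1 : (enc (c :: r, b, a)).size = 1 + (1 + sz c + sz r) + (1 + sz b + sz a) := rfl
        have e2 : (Op.fst.apply (enc (c :: r, b, a))).size = 1 + sz c + sz r := rfl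
        have e3 : (Op.snd.apply (enc (c :: r, b, a))).size = 1 + sz b + sz a := rfl
        have e4 : sz (c :: r, b, a) = 1 + (1 + sz c + sz r) + (1 + sz b + sz a) := rfl
        rw [e1, e2, e3, e4]
        set p := 1 + sz c + sz r
        set q := 1 + sz b + sz a
        nlinarith
      obtain ⟨t₂, ht₂, he₂⟩ := hexec
      refine ⟨1 + sz (c :: r, b, a) + t + t₂ + t₃, ?_, fun ε o => ?_⟩
      · have h1 := eval_mono R hsz
        have h2 := eval_mono Q hsz'
        have h4 : (1 + sz (c :: r, b, a)) ^ 2 ≤ (1 + W.eval (sz a)) ^ 2 := by gcongr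
        have h3 : 1 + sz (c :: r, b, a) + t + t₂ ≤ K.eval (sz a) := by
          simp only [K, eval_add, eval_mul, eval_pow, eval_one, eval_comp, eval_ofNat]
          nlinarith
        rw [List.length_cons]
        nlinarith
      · have h1 := he ε o
        simp only [reduceCtorEq, not_false_eq_true, if_true] at h1
        exact Exec.loop_step (l₁ := []) (l₂ := []) (l₃ := []) h1 (by simp [enc]) (he₂ ε o) (he₃ ε o)
  have hmain : PolyTime fun a => (([] : List γ), (l a).foldl (f a) (init a), a) := by
    obtain ⟨A, T, hA⟩ := hstart
    refine ⟨.seq A (.loop D body), 1 + T + (Ql + 1) * K, fun a => ?_⟩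
    obtain ⟨t, ht, he⟩ := hA a
    obtain ⟨t', ht', he'⟩ := hloop a (l a) (init a) [] rfl rfl
    refine ⟨1 + t + t', ?_, fun ε o => by simpa using (he ε o).seq (he' ε o)⟩
    have h1 := (length_lt_sz (l a)).le.trans (hQl a)
    have h2 : ((l a).length + 1) * K.eval (sz a) ≤ (Ql.eval (sz a) + 1) * K.eval (sz a) := by
      gcongr
    simp only [eval_add, eval_mul, eval_one]
    omega
  exact fst.comp (snd.comp hmain)

end PolyTime

/-! ### The greedy algorithm -/

/-- The number of edges in a list that are incident to `v`. -/
def incid (L : List (ℕ × ℕ)) (v : ℕ) : ℕ := L.countP fun e => e.1 = v ∨ e.2 = v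

/-- Comparison of fractions `(numerator, denominator)`; `(1, 0)` serves as infinity. -/
def FracLE (x y : ℕ × ℕ) : Prop := x.1 * y.2 ≤ y.1 * x.2

instance (x y : ℕ × ℕ) : Decidable (FracLE x y) := inferInstanceAs (Decidable (_ ≤ _))

/-- A state of the algorithm: the vertex probabilities, the edges not yet probed, the edges found
active, the edges found inactive, and the number of active edges that are still needed. -/
structure State where
  probs : List (ℕ × ℕ)
  unprobed : List (ℕ × ℕ)
  active : List (ℕ × ℕ)
  inactive : List (ℕ × ℕ)
  need : ℕ

namespace State

/-- The priority of a vertex as a fraction: zero if an incident edge was found inactive, infinity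
if otherwise an incident edge was found active, and otherwise the expected number of useful active
edges that the vertex provides. -/
def score (s : State) (v : ℕ) : ℕ × ℕ :=
  if 0 < incid s.inactive v then (0, 1)
  else if 0 < incid s.active v then (1, 0)
  else ((s.probs.getD v (0, 1)).1 * min s.need (incid s.unprobed v), (s.probs.getD v (0, 1)).2)

/-- The endpoint of larger priority. -/
def top (s : State) (e : ℕ × ℕ) : ℕ := if FracLE (s.score e.1) (s.score e.2) then e.2 else e.1

/-- Insertion of an edge into a list of edges that has an edge of largest priority in front. -/
def insert (s : State) (l : List (ℕ × ℕ)) (x : ℕ × ℕ) : List (ℕ × ℕ) :=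
  match l with
  | [] => [x]
  | b :: r => if FracLE (s.score (s.top x)) (s.score (s.top b)) then b :: x :: r else x :: b :: r

/-- The unprobed edges, one of largest priority in front. -/
def order (s : State) : List (ℕ × ℕ) := s.unprobed.foldl s.insert []

/-- The next edge to be probed, and the state without this edge. -/
def pick (s : State) : (ℕ × ℕ) × State :=
  match s.order with
  | [] => ((0, 0), s)
  | e :: r => (e, ⟨s.probs, r, s.active, s.inactive, s.need⟩)

/-- Recording the result `b` of the probe of `e`. -/
def record (e : ℕ × ℕ) (s : State) (b : ℕ) : State :=
  if b = 0 then ⟨s.probs, s.unprobed, s.active, e :: s.inactive, s.need⟩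
  else ⟨s.probs, s.unprobed, e :: s.active, s.inactive, s.need - 1⟩

/-- The algorithm goes on as long as there are unprobed edges and active edges are needed. -/
def Running (s : State) : Prop := ¬ s.unprobed = [] ∧ ¬ s.need = 0

instance : DecidablePred Running := fun _ => inferInstanceAs (Decidable (_ ∧ _))

/-- The state after the next probe, when `X` gives the states of the edges. -/
def next (X : ℕ × ℕ → Bool) (s : State) : State :=
  if s.Running then record s.pick.1 s.pick.2 (X s.pick.1).toNat else s

/-- The edges probed in the next `m` rounds. -/
def probeList (X : ℕ × ℕ → Bool) : ℕ → State → List (ℕ × ℕ)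
  | 0, _ => []
  | m + 1, s => if s.Running then s.pick.1 :: probeList X m (s.next X) else []

theorem insert_perm (s : State) (l : List (ℕ × ℕ)) (x : ℕ × ℕ) : (s.insert l x).Perm (x :: l) := by
  unfold insert
  split
  · rfl
  · split
    · exact List.Perm.swap _ _ _
    · rfl

theorem foldl_insert_perm (s : State) (l l₀ : List (ℕ × ℕ)) :
    (l.foldl s.insert l₀).Perm (l ++ l₀) := by
  induction l generalizing l₀ with
  | nil => rfl
  | cons x l ih =>
    refine (ih _).trans ?_
    refine ((s.insert_perm l₀ x).append_left l).trans ?_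
    exact List.perm_middle

theorem order_perm (s : State) : s.order.Perm s.unprobed := by
  simpa [order] using s.foldl_insert_perm s.unprobed []

theorem order_eq_of_running {s : State} (h : s.Running) :
    s.order = s.pick.1 :: s.pick.2.unprobed := by
  unfold pick
  split
  · rename_i h'
    have := s.order_perm
    rw [h'] at this
    exact absurd this.nil_eq.symm h.1
  · assumption

theorem unprobed_perm {s : State} (h : s.Running) :
    s.unprobed.Perm (s.pick.1 :: s.pick.2.unprobed) := by
  rw [← order_eq_of_running h]
  exact s.order_perm.symm

theorem pick_probs (s : State) : s.pick.2.probs = s.probs := by unfold pick; split <;> rfl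
theorem pick_active (s : State) : s.pick.2.active = s.active := by unfold pick; split <;> rfl
theorem pick_inactive (s : State) : s.pick.2.inactive = s.inactive := by
  unfold pick; split <;> rfl
theorem pick_need (s : State) : s.pick.2.need = s.need := by unfold pick; split <;> rfl

theorem next_of_not_running {X : ℕ × ℕ → Bool} {s : State} (h : ¬ s.Running) : s.next X = s :=
  if_neg h

theorem next_of_active {X : ℕ × ℕ → Bool} {s : State} (h : s.Running) (hX : X s.pick.1 = true) :
    s.next X =
      ⟨s.probs, s.pick.2.unprobed, s.pick.1 :: s.active, s.inactive, s.need - 1⟩ := by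
  simp [next, h, hX, record, pick_probs, pick_active, pick_inactive, pick_need]

theorem next_of_inactive {X : ℕ × ℕ → Bool} {s : State} (h : s.Running)
    (hX : X s.pick.1 = false) :
    s.next X = ⟨s.probs, s.pick.2.unprobed, s.active, s.pick.1 :: s.inactive, s.need⟩ := by
  simp [next, h, hX, record, pick_probs, pick_active, pick_inactive, pick_need]

end State

/-! ### Its running time -/

instance : Enc State := ⟨fun s => enc (s.probs, s.unprobed, s.active, s.inactive, s.need)⟩

namespace PolyTime

theorem congr {f g : α → β} (h : ∀ a, f a = g a) (hf : PolyTime f) : PolyTime g :=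
  funext h ▸ hf

theorem probs : PolyTime State.probs := of_op .fst fun _ => rfl

theorem state_snd : PolyTime fun s : State => (s.unprobed, s.active, s.inactive, s.need) :=
  of_op .snd fun _ => rfl

theorem unprobed : PolyTime State.unprobed := fst.comp state_snd

theorem active : PolyTime State.active := fst.comp (snd.comp state_snd)

theorem inactive : PolyTime State.inactive := fst.comp (snd.comp (snd.comp state_snd))

theorem need : PolyTime State.need := snd.comp (snd.comp (snd.comp state_snd))

theorem mk {f₁ f₂ f₃ f₄ : α → List (ℕ × ℕ)} {f₅ : α → ℕ}
    (h₁ : PolyTime f₁) (h₂ : PolyTime f₂) (h₃ : PolyTime f₃)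
    (h₄ : PolyTime f₄) (h₅ : PolyTime f₅) :
      PolyTime fun a => State.mk (f₁ a) (f₂ a) (f₃ a) (f₄ a) (f₅ a) :=
  (of_op (f := fun x : List (ℕ × ℕ) × List (ℕ × ℕ) × List (ℕ × ℕ) × List (ℕ × ℕ) × ℕ =>
    State.mk x.1 x.2.1 x.2.2.1 x.2.2.2.1 x.2.2.2.2) .id fun _ => rfl).comp
    (h₁.pair (h₂.pair (h₃.pair (h₄.pair h₅))))

theorem incid {L : α → List (ℕ × ℕ)} {v : α → ℕ} (hL : PolyTime L) (hv : PolyTime v) :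
    PolyTime fun a => incid (L a) (v a) := by
  have key : ∀ (v c : ℕ) (L : List (ℕ × ℕ)),
      L.foldl (fun c e => if e.1 = v ∨ e.2 = v then c + 1 else c) c =
        c + GraphProbing.incid L v := by
    intro v c L
    induction L generalizing c with
    | nil => rfl
    | cons e L ih =>
      rw [List.foldl_cons, ih, GraphProbing.incid, GraphProbing.incid, List.countP_cons]
      by_cases h : e.1 = v ∨ e.2 = v
      · simp [h]; omega
      · simp [h]
  have hfold : PolyTime fun x : List (ℕ × ℕ) × ℕ =>
      x.1.foldl (fun c e => if e.1 = x.2 ∨ e.2 = x.2 then c + 1 else c) 0 := by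
    refine foldl (S := 1 + X) (f := fun (x : List (ℕ × ℕ) × ℕ) (c : ℕ) (e : ℕ × ℕ) =>
      if e.1 = x.2 ∨ e.2 = x.2 then c + 1 else c) fst (const 0) ?_ ?_
    · exact ite (((fst.comp fst).eq (snd.comp (snd.comp snd))).or
        ((snd.comp fst).eq (snd.comp (snd.comp snd)))) ((fst.comp snd).add (const 1)) (fst.comp snd)
    · intro x l' h
      have h1 := sz_prefix_le h
      have h2 := length_lt_sz l'
      have h3 : GraphProbing.incid l' x.2 ≤ l'.length := List.countP_le_length
      have h4 := sz_nat_le (GraphProbing.incid l' x.2)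
      have h5 : sz x = 1 + sz x.1 + sz x.2 := rfl
      rw [key, zero_add]
      simp only [eval_add, eval_one, eval_X]
      omega
  convert hfold.comp (hL.pair hv) using 2 with a
  rw [key, zero_add]

theorem getD {L : α → List (ℕ × ℕ)} {v : α → ℕ} (hL : PolyTime L) (hv : PolyTime v) :
    PolyTime fun a => (L a).getD (v a) (0, 1) := by
  have key : ∀ (v i : ℕ) (r : ℕ × ℕ) (L : List (ℕ × ℕ)),
      L.foldl (fun c e => (c.1 + 1, if c.1 = v then e else c.2)) (i, r) =
        (i + L.length, if i ≤ v then L.getD (v - i) r else r) := by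
    intro v i r L
    induction L generalizing i r with
    | nil => simp
    | cons e L ih =>
      rw [List.foldl_cons, ih]
      refine Prod.ext (by simp only [List.length_cons]; omega) ?_
      dsimp only
      rcases lt_trichotomy i v with h | rfl | h
      · obtain ⟨j, rfl⟩ : ∃ j, v = i + 1 + j := ⟨v - (i + 1), by omega⟩
        have h1 : i + 1 + j - i = j + 1 := by omega
        have h2 : i + 1 + j - (i + 1) = j := by omega
        have h3 : i ≠ i + 1 + j := by omega
        have h4 : i ≤ i + 1 + j := by omega
        rw [if_pos (by omega), if_pos h4, h1, h2, if_neg h3, List.getD_cons_succ]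
      · simp
      · have h1 : ¬ i + 1 ≤ v := by omega
        have h2 : ¬ i ≤ v := by omega
        have h3 : i ≠ v := by omega
        rw [if_neg h1, if_neg h2, if_neg h3]
  have hfold : PolyTime fun x : List (ℕ × ℕ) × ℕ =>
      x.1.foldl (fun c e => (c.1 + 1, if c.1 = x.2 then e else c.2)) (0, (0, 1)) := by
    refine foldl (S := 10 + 2 * X)
      (f := fun (x : List (ℕ × ℕ) × ℕ) (c : ℕ × (ℕ × ℕ)) (e : ℕ × ℕ) =>
        (c.1 + 1, if c.1 = x.2 then e else c.2)) fst (const (0, (0, 1))) ?_ ?_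
    · exact ((fst.comp (fst.comp snd)).add (const 1)).pair
        (ite ((fst.comp (fst.comp snd)).eq (snd.comp (snd.comp snd))) fst
          (snd.comp (fst.comp snd)))
    · intro x l' h
      have h1 := sz_prefix_le h
      have h2 := length_lt_sz l'
      have h4 := sz_nat_le (0 + l'.length)
      have h5 : sz x = 1 + sz x.1 + sz x.2 := rfl
      have h6 : sz ((0, 1) : ℕ × ℕ) = 4 := by decide
      have h7 : sz (l'.getD x.2 (0, 1)) ≤ sz l' + 4 := by
        rcases lt_or_ge x.2 l'.length with h | h
        · rw [List.getD_eq_getElem _ _ h]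
          have := sz_mem_le (List.getElem_mem h)
          omega
        · rw [List.getD_eq_default _ _ h]; omega
      rw [key, sz_prod]
      simp only [eval_add, eval_mul, eval_ofNat, eval_X, Nat.zero_le, if_true, Nat.sub_zero]
      omega
  convert (snd.comp hfold).comp (hL.pair hv) using 2 with a
  rw [key]
  simp

theorem lt {f g : α → ℕ} (hf : PolyTime f) (hg : PolyTime g) : PolyTimePred fun a => f a < g a :=
  (hf.add (const 1)).le hg

theorem fracLE {f g : α → ℕ × ℕ} (hf : PolyTime f) (hg : PolyTime g) :
    PolyTimePred fun a => FracLE (f a) (g a) :=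
  ((fst.comp hf).mul (snd.comp hg)).le ((fst.comp hg).mul (snd.comp hf))

theorem min {f g : α → ℕ} (hf : PolyTime f) (hg : PolyTime g) :
    PolyTime fun a => min (f a) (g a) := by
  convert PolyTime.ite (hf.le hg) hf hg using 2 with a
  exact min_def _ _

theorem score {s : α → State} {v : α → ℕ} (hs : PolyTime s) (hv : PolyTime v) :
    PolyTime fun a => (s a).score (v a) := by
  have hp := (probs.comp hs).getD hv
  exact ite (lt (const 0) ((inactive.comp hs).incid hv)) (const (0, 1))
    (ite (lt (const 0) ((active.comp hs).incid hv)) (const (1, 0))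
      (((fst.comp hp).mul ((need.comp hs).min ((unprobed.comp hs).incid hv))).pair (snd.comp hp)))

theorem top {s : α → State} {e : α → ℕ × ℕ} (hs : PolyTime s) (he : PolyTime e) :
    PolyTime fun a => (s a).top (e a) :=
  ite (fracLE (hs.score (fst.comp he)) (hs.score (snd.comp he))) (snd.comp he) (fst.comp he)

theorem order : PolyTime State.order := by
  refine foldl (S := X) (f := fun s : State => s.insert) (init := fun _ => []) unprobed (const [])
    ?_ ?_
  · have hs :
    PolyTime fun x : ((ℕ × ℕ) × List (ℕ × ℕ) × State) × (ℕ × ℕ) × List (ℕ × ℕ) => x.1.2.2 :=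
      snd.comp (snd.comp fst)
    have hx : PolyTime fun x : ((ℕ × ℕ) × List (ℕ × ℕ) × State) × (ℕ × ℕ) × List (ℕ × ℕ) => x.1.1 :=
      fst.comp fst
    have hb : PolyTime fun x : ((ℕ × ℕ) × List (ℕ × ℕ) × State) × (ℕ × ℕ) × List (ℕ × ℕ) => x.2.1 :=
      fst.comp snd
    have hr : PolyTime fun x : ((ℕ × ℕ) × List (ℕ × ℕ) × State) × (ℕ × ℕ) × List (ℕ × ℕ) => x.2.2 :=
      snd.comp snd
    refine congr (fun x => ?_) <| listCases (l := fun x : (ℕ × ℕ) × List (ℕ × ℕ) × State => x.2.1)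
      (g := fun x b r => if FracLE (x.2.2.score (x.2.2.top x.1)) (x.2.2.score (x.2.2.top b))
        then b :: x.1 :: r else x.1 :: b :: r) (fst.comp snd) (fst.cons (const []))
      (ite (fracLE (hs.score (hs.top hx)) (hs.score (hs.top hb))) (hb.cons (hx.cons hr))
        (hx.cons (hb.cons hr)))
    rcases x with ⟨x, _ | ⟨b, r⟩, s⟩ <;> rfl
  · intro s l' h
    have h1 := sz_perm (s.foldl_insert_perm l' [])
    rw [List.append_nil] at h1
    have h2 := sz_prefix_le h
    have h3 : sz s = 1 + sz s.probs + (1 + sz s.unprobed +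
      sz (s.active, s.inactive, s.need)) := rfl
    rw [h1, eval_X]
    omega

theorem pick : PolyTime State.pick := by
  have hs : PolyTime fun x : State × (ℕ × ℕ) × List (ℕ × ℕ) => x.1 := fst
  have h₁ : PolyTime fun x : State × (ℕ × ℕ) × List (ℕ × ℕ) => x.1.probs := probs.comp hs
  have h₂ : PolyTime fun x : State × (ℕ × ℕ) × List (ℕ × ℕ) => x.2.2 := snd.comp snd
  have h₃ : PolyTime fun x : State × (ℕ × ℕ) × List (ℕ × ℕ) => x.1.active := active.comp hs
  have h₄ : PolyTime fun x : State × (ℕ × ℕ) × List (ℕ × ℕ) => x.1.inactive := inactive.comp hs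
  have h₅ : PolyTime fun x : State × (ℕ × ℕ) × List (ℕ × ℕ) => x.1.need := need.comp hs
  have hm := mk h₁ h₂ h₃ h₄ h₅
  refine congr (fun s => ?_) <|
  listCases (g := fun s e r =>
    (e, ⟨s.probs, r, s.active, s.inactive, s.need⟩)) order ((const (0, 0)).pair id)
    ((fst.comp snd).pair hm)
  unfold State.pick
  rcases s.order with _ | ⟨e, r⟩ <;> rfl

theorem record : PolyTime fun x : ((ℕ × ℕ) × State) × ℕ => State.record x.1.1 x.1.2 x.2 := by
  have he : PolyTime fun x : ((ℕ × ℕ) × State) × ℕ => x.1.1 := fst.comp fst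
  have hs : PolyTime fun x : ((ℕ × ℕ) × State) × ℕ => x.1.2 := snd.comp fst
  exact ite (snd.eq (const 0))
    (mk (probs.comp hs) (unprobed.comp hs) (active.comp hs) (he.cons (inactive.comp hs))
      (need.comp hs))
    (mk (probs.comp hs) (unprobed.comp hs) (he.cons (active.comp hs)) (inactive.comp hs)
      ((need.comp hs).sub (const 1)))

theorem running : PolyTimePred State.Running := unprobed.isEmpty.not.and (need.eq (const 0)).not

end PolyTime

namespace State

theorem sz_eq (s : State) : sz s = 4 + sz s.probs + sz s.unprobed + sz s.active + sz s.inactive +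
    sz s.need := by
  have : sz s = 1 + sz s.probs + (1 + sz s.unprobed + (1 + sz s.active + (1 + sz s.inactive +
    sz s.need))) := rfl
  omega

theorem sz_next_le (X : ℕ × ℕ → Bool) (s : State) : sz (s.next X) ≤ sz s := by
  by_cases h : s.Running
  · have h1 := sz_perm (unprobed_perm h)
    rw [sz_cons] at h1
    cases hX : X s.pick.1
    · rw [next_of_inactive h hX, sz_eq, sz_eq, sz_cons]
      dsimp only
      omega
    · rw [next_of_active h hX, sz_eq, sz_eq, sz_cons]
      have : sz (s.need - 1) ≤ sz s.need := by
        have := Nat.size_le_size (Nat.sub_le s.need 1)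
        change 1 + Nat.size _ ≤ 1 + Nat.size _
        omega
      dsimp only
      omega
  · rw [next_of_not_running h]

theorem mem_unprobed_of_mem_next {X : ℕ × ℕ → Bool} {s : State} {e : ℕ × ℕ}
    (h : e ∈ (s.next X).unprobed) : e ∈ s.unprobed := by
  by_cases hr : s.Running
  · refine (unprobed_perm hr).mem_iff.2 (List.mem_cons_of_mem _ ?_)
    cases hX : X s.pick.1
    · rwa [next_of_inactive hr hX] at h
    · rwa [next_of_active hr hX] at h
  · rwa [next_of_not_running hr] at h

theorem length_unprobed_next {X : ℕ × ℕ → Bool} {s : State} (hr : s.Running) :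
    (s.next X).unprobed.length + 1 = s.unprobed.length := by
  rw [(unprobed_perm hr).length_eq, List.length_cons]
  cases hX : X s.pick.1
  · rw [next_of_inactive hr hX]
  · rw [next_of_active hr hX]

end State

/-- The main loop is executed in polynomial time, for every oracle that answers the probes of the
unprobed edges. -/
theorem exists_loop : ∃ (B : Prog) (T : ℕ[X]), ∀ (ε : Type) (oracle : Data → Option (ε × Bool))
    (X : ℕ × ℕ → Bool) (ed : ℕ × ℕ → ε) (s : State),
    (∀ e ∈ s.unprobed, oracle (enc e) = some (ed e, X e)) →
    ∃ (out : Data) (t : ℕ), t ≤ T.eval (sz s) ∧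
      Exec oracle B (enc s) out ((s.probeList X s.unprobed.length).map ed) t := by
  obtain ⟨D, R, hD⟩ := PolyTime.running
  obtain ⟨F, Q, hF⟩ := PolyTime.pick
  obtain ⟨G, U, hG⟩ := PolyTime.record
  obtain ⟨H, V, hH⟩ := (PolyTime.fst : PolyTime fun x : (ℕ × ℕ) × State => x.1)
  obtain ⟨J, W, hJ⟩ := (PolyTime.id : PolyTime fun x : (ℕ × ℕ) × State => x)
  let body : Prog := .seq F (.seq (.pair J (.seq H .probe)) G)
  let K : ℕ[X] := 10 + X + R + Q + (Q + W.comp Q + V.comp Q + Q + 10) + U.comp (3 + Q)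
  refine ⟨.loop D body, (X + 1) * K, fun ε oracle X ed s hs => ?_⟩
  have main : ∀ (m N : ℕ) (s : State), s.unprobed.length = m → sz s ≤ N →
      (∀ e ∈ s.unprobed, oracle (enc e) = some (ed e, X e)) →
      ∃ (out : Data) (t : ℕ), t ≤ (m + 1) * K.eval N ∧
        Exec oracle (.loop D body) (enc s) out ((s.probeList X m).map ed) t := by
    intro m N
    -- the last test of the loop
    have halted : ∀ s : State, sz s ≤ N → ¬ s.Running → ∃ (out : Data) (t : ℕ), t ≤ K.eval N ∧
        Exec oracle (.loop D body) (enc s) out [] t := by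
      intro s hsN hr
      obtain ⟨t, ht, he⟩ := hD s
      have h1 := he ε oracle
      simp only [if_neg hr] at h1
      refine ⟨_, _, ?_, Exec.loop_stop h1⟩
      have h2 := eval_mono R hsN
      have h3 : (enc s).size ≤ N := hsN
      simp only [K, eval_add, eval_ofNat, eval_X]
      omega
    induction m with
    | zero =>
      intro s hm hsN _
      obtain ⟨out, t, ht, he⟩ := halted s hsN fun h => h.1 (List.length_eq_zero_iff.1 hm)
      exact ⟨out, t, by simpa using ht, he⟩
    | succ m ih =>
      intro s hm hsN ho
      by_cases hr : s.Running
      · obtain ⟨t₁, ht₁, he₁⟩ := hD s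
        obtain ⟨t₂, ht₂, he₂⟩ := hF s
        obtain ⟨t₃, ht₃, he₃⟩ := hJ s.pick
        obtain ⟨t₄, ht₄, he₄⟩ := hH s.pick
        obtain ⟨t₅, ht₅, he₅⟩ := hG (s.pick, (X s.pick.1).toNat)
        obtain ⟨out, t₆, ht₆, he₆⟩ := ih (s.next X)
          (by have := State.length_unprobed_next (X := X) hr; omega) ((s.sz_next_le X).trans hsN)
          fun e he => ho e (State.mem_unprobed_of_mem_next he)
        have h1 := he₁ ε oracle
        have h2 := he₂ ε oracle
        have h3 := he₃ ε oracle
        have h4 := he₄ ε oracle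
        have h5 := he₅ ε oracle
        simp only [if_pos hr] at h1
        have hp : Exec oracle .probe (enc s.pick.1) (.num (X s.pick.1).toNat) [ed s.pick.1]
            (1 + sz s.pick.1) :=
          .probe (ho _ ((State.unprobed_perm hr).mem_iff.2 (by simp)))
        have hn : s.next X = State.record s.pick.1 s.pick.2 (X s.pick.1).toNat := if_pos hr
        rw [hn] at he₆
        have hb := Exec.loop_step (l₁ := []) (l₂ := [ed s.pick.1]) h1 (by simp [enc])
          (.seq (l₁ := []) (l₂ := [ed s.pick.1]) h2 (.seq (l₁ := [ed s.pick.1]) (l₂ := [])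
            (.pair (l₁ := []) (l₂ := [ed s.pick.1]) h3
              (.seq (l₁ := []) (l₂ := [ed s.pick.1]) h4 hp)) h5)) he₆
        have hl : (s.probeList X (m + 1)).map ed = [] ++ [ed s.pick.1] ++ (State.probeList X m
            (State.record s.pick.1 s.pick.2 (X s.pick.1).toNat)).map ed := by
          rw [State.probeList, if_pos hr, hn]
          rfl
        rw [hl]
        refine ⟨out, _, ?_, hb⟩
        · have e0 : (enc s).size ≤ N := hsN
          have e1 := eval_mono R hsN
          have e2 := eval_mono Q hsN
          have hpk : sz s.pick ≤ Q.eval N := (h2.size_le.trans ht₂).trans e2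
          have e3 := eval_mono W hpk
          have e4 := eval_mono V hpk
          have hpk' : sz s.pick = 1 + sz s.pick.1 + sz s.pick.2 := rfl
          have hu : sz (s.pick, (X s.pick.1).toNat) ≤ 3 + Q.eval N := by
            rw [sz_prod]
            have : sz (X s.pick.1).toNat ≤ 2 := by cases X s.pick.1 <;> decide
            omega
          have e5 := eval_mono U hu
          have e6 : (enc s.pick).size ≤ Q.eval N := hpk
          have hK : K.eval N = 10 + N + R.eval N + Q.eval N +
              (Q.eval N + W.eval (Q.eval N) + V.eval (Q.eval N) + Q.eval N + 10) +
              U.eval (3 + Q.eval N) := by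
            simp only [K, eval_add, eval_ofNat, eval_X, eval_comp]
          rw [add_mul _ 1, one_mul]
          omega
      · obtain ⟨out, t, ht, he⟩ := halted s hsN hr
        refine ⟨out, t, ht.trans (Nat.le_mul_of_pos_left _ (by omega)), ?_⟩
        rwa [State.probeList, if_neg hr]
  obtain ⟨out, t, ht, he⟩ := main _ (sz s) s rfl le_rfl hs
  refine ⟨out, t, ht.trans ?_, he⟩
  have h1 := length_lt_sz s.unprobed
  have h2 := s.sz_eq
  simp only [eval_mul, eval_add, eval_X, eval_one]
  gcongr
  omega

/-! ### The choice of the next edge -/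

theorem incid_pos {L : List (ℕ × ℕ)} {v : ℕ} : 0 < incid L v ↔ ∃ e ∈ L, e.1 = v ∨ e.2 = v := by
  simp [incid, List.countP_pos_iff]

theorem incid_cons (e : ℕ × ℕ) (L : List (ℕ × ℕ)) (v : ℕ) :
    incid (e :: L) v = incid L v + if e.1 = v ∨ e.2 = v then 1 else 0 := by
  simp [incid, List.countP_cons]

namespace FracLE

theorem total {x y : ℕ × ℕ} (h : ¬ FracLE x y) : FracLE y x := (not_le.1 h).le

theorem trans {x y z : ℕ × ℕ} (hy : 0 < y.1 ∨ 0 < y.2) (hxy : FracLE x y) (hyz : FracLE y z) :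
    FracLE x z := by
  unfold FracLE at *
  rcases Nat.eq_zero_or_pos y.2 with h | h
  · rw [h, mul_zero] at hyz
    have hz : z.2 = 0 := by
      rcases Nat.mul_eq_zero.1 (Nat.le_zero.1 hyz) with h' | h'
      · omega
      · exact h'
    simp [hz]
  · refine Nat.le_of_mul_le_mul_right ?_ h
    calc x.1 * z.2 * y.2 = x.1 * y.2 * z.2 := by ring
      _ ≤ y.1 * x.2 * z.2 := Nat.mul_le_mul_right _ hxy
      _ = y.1 * z.2 * x.2 := by ring
      _ ≤ z.1 * y.2 * x.2 := Nat.mul_le_mul_right _ hyz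
      _ = z.1 * x.2 * y.2 := by ring

end FracLE

namespace State

/-- An edge at `v` was found active, none was found inactive. -/
def Hot (s : State) (v : ℕ) : Prop := 0 < incid s.active v ∧ incid s.inactive v = 0

/-- No edge at `v` has been probed. -/
def Fresh (s : State) (v : ℕ) : Prop := incid s.active v = 0 ∧ incid s.inactive v = 0

instance (s : State) : DecidablePred s.Hot := fun _ => inferInstanceAs (Decidable (_ ∧ _))

instance (s : State) : DecidablePred s.Fresh := fun _ => inferInstanceAs (Decidable (_ ∧ _))

/-- The endpoint of largest priority of the edge that is probed next. -/
def lead (s : State) : ℕ := s.top s.pick.1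

/-- In the state `s` an edge without hot endpoints is probed. -/
def Seed (s : State) : Prop := s.Running ∧ ¬ s.Hot s.lead

instance : DecidablePred Seed := fun _ => inferInstanceAs (Decidable (_ ∧ _))

/-- The listed probabilities are fractions with positive denominators. -/
def ProbsPos (s : State) : Prop := ∀ v, 0 < (s.probs.getD v (0, 1)).2

theorem score_pos {s : State} (h : s.ProbsPos) (v : ℕ) : 0 < (s.score v).1 ∨ 0 < (s.score v).2 := by
  unfold score
  split
  · simp
  · split
    · simp
    · exact Or.inr (h v)

theorem lead_eq (s : State) : s.pick.1.1 = s.lead ∨ s.pick.1.2 = s.lead := by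
  unfold lead top
  split <;> simp

theorem score_le_top {s : State} {e : ℕ × ℕ} {v : ℕ} (h : e.1 = v ∨ e.2 = v) :
    FracLE (s.score v) (s.score (s.top e)) := by
  unfold top
  split
  · rename_i hle
    rcases h with rfl | rfl
    · exact hle
    · exact le_refl _
  · rename_i hle
    rcases h with rfl | rfl
    · exact le_refl _
    · exact (FracLE.total hle)

/-- No edge of the list has larger priority than the first one. -/
def HeadMax (s : State) (l : List (ℕ × ℕ)) : Prop :=
  ∀ b r, l = b :: r → ∀ x ∈ l, FracLE (s.score (s.top x)) (s.score (s.top b))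

theorem headMax_insert {s : State} (h : s.ProbsPos) {l : List (ℕ × ℕ)} (hl : s.HeadMax l)
    (x : ℕ × ℕ) : s.HeadMax (s.insert l x) := by
  intro b r hb y hy
  rcases l with _ | ⟨c, l⟩
  · obtain ⟨rfl, rfl⟩ := List.cons.inj hb
    obtain rfl : y = x := by simpa [insert] using hy
    exact le_refl _
  · have hc := hl c l rfl
    have hy' : y = x ∨ y ∈ c :: l := by
      simpa using (s.insert_perm (c :: l) x).mem_iff.1 hy
    unfold insert at hb
    dsimp only at hb
    split at hb
    · rename_i hle
      obtain ⟨rfl, -⟩ := List.cons.inj hb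
      rcases hy' with rfl | hy'
      · exact hle
      · exact hc y hy'
    · rename_i hle
      obtain ⟨rfl, -⟩ := List.cons.inj hb
      rcases hy' with rfl | hy'
      · exact le_refl _
      · exact (hc y hy').trans (score_pos h _) (FracLE.total hle)

theorem headMax_order {s : State} (h : s.ProbsPos) : s.HeadMax s.order := by
  have : ∀ (l l₀ : List (ℕ × ℕ)), s.HeadMax l₀ → s.HeadMax (l.foldl s.insert l₀) := by
    intro l
    induction l with
    | nil => exact fun _ h => h
    | cons x l ih => exact fun l₀ h₀ => ih _ (headMax_insert h h₀ x)
  exact this _ [] fun b r hb => by simp at hb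

/-- No endpoint of an unprobed edge has a larger priority than the leading vertex. -/
theorem score_le_lead {s : State} (h : s.ProbsPos) (hr : s.Running) {e : ℕ × ℕ}
    (he : e ∈ s.unprobed) {v : ℕ} (hv : e.1 = v ∨ e.2 = v) :
    FracLE (s.score v) (s.score s.lead) := by
  refine (score_le_top hv).trans (score_pos h _) ?_
  exact headMax_order h _ _ (order_eq_of_running hr) e (s.order_perm.mem_iff.2 he)

theorem score_of_hot {s : State} {v : ℕ} (h : s.Hot v) : s.score v = (1, 0) := by
  rw [score, if_neg (by rw [h.2]; simp), if_pos h.1]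

/-- When the leading vertex is not hot, then no endpoint of an unprobed edge is. -/
theorem Seed.not_hot {s : State} (hs : s.Seed) (h : s.ProbsPos) {e : ℕ × ℕ} (he : e ∈ s.unprobed)
    {v : ℕ} (hv : e.1 = v ∨ e.2 = v) : ¬ s.Hot v := by
  intro hhot
  have h1 := score_le_lead h hs.1 he hv
  rw [score_of_hot hhot, FracLE, mul_zero, one_mul] at h1
  revert h1
  unfold score
  split
  · simp
  · rename_i h2
    rw [if_neg fun h3 => hs.2 ⟨h3, by omega⟩]
    have := h s.lead
    dsimp only
    omega

theorem pick_mem {s : State} (hr : s.Running) : s.pick.1 ∈ s.unprobed :=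
  (unprobed_perm hr).mem_iff.2 (by simp)

theorem incid_unprobed {s : State} (hr : s.Running) (v : ℕ) :
    incid s.unprobed v =
      incid s.pick.2.unprobed v + if s.pick.1.1 = v ∨ s.pick.1.2 = v then 1 else 0 := by
  rw [← incid_cons]
  exact (unprobed_perm hr).countP_eq _

end State

/-! ### Runs of the algorithm -/

/-- The state of an edge under the vertex outcome `Y`. -/
def edgeState (Y : ℕ → Bool) (e : ℕ × ℕ) : Bool := Y e.1 || Y e.2

/-- The state after `i` rounds. -/
def run (Y : ℕ → Bool) (s : State) (i : ℕ) : State := (State.next (edgeState Y))^[i] s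

theorem run_succ (Y : ℕ → Bool) (s : State) (i : ℕ) :
    run Y s (i + 1) = (run Y s i).next (edgeState Y) := Function.iterate_succ_apply' _ _ _

/-- The number of seeds, that is, of probes of edges without hot endpoints, in the first `i`
rounds. -/
def seeds (Y : ℕ → Bool) (s : State) (i : ℕ) : ℕ :=
  ∑ j ∈ Finset.range i, if (run Y s j).Seed then 1 else 0

theorem seeds_succ (Y : ℕ → Bool) (s : State) (i : ℕ) :
    seeds Y s (i + 1) = seeds Y s i + if (run Y s i).Seed then 1 else 0 :=
  Finset.sum_range_succ _ _

theorem length_probeList (Y : ℕ → Bool) (m : ℕ) (s : State) :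
    (s.probeList (edgeState Y) m).length =
      ∑ j ∈ Finset.range m, if (run Y s j).Running then 1 else 0 := by
  induction m generalizing s with
  | zero => rfl
  | succ m ih =>
    rw [State.probeList]
    split
    · rename_i h
      rw [List.length_cons, ih, Finset.sum_range_succ' _ m, run, Function.iterate_zero, id,
        if_pos h]
      rfl
    · rename_i h
      have : ∀ j, run Y s j = s := by
        intro j
        induction j with
        | zero => rfl
        | succ j ih => rw [run_succ, ih, State.next_of_not_running h]
      simp [this, h]

/-- The states that can be reached when `k` of the edges `E` are to be found under `Y`. -/
structure Reachable (P E : List (ℕ × ℕ)) (k : ℕ) (Y : ℕ → Bool) (s : State) : Prop where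
  probs : s.probs = P
  perm : (s.unprobed ++ s.active ++ s.inactive).Perm E
  active : ∀ e ∈ s.active, edgeState Y e = true
  inactive : ∀ e ∈ s.inactive, edgeState Y e = false
  need : s.need + s.active.length = k

/-- The standing assumptions on the lists of probabilities and edges. -/
structure Wf (n : ℕ) (P E : List (ℕ × ℕ)) : Prop where
  den_pos : ∀ v, 0 < (P.getD v (0, 1)).2
  lt : ∀ e ∈ E, e.1 < e.2 ∧ e.2 < n
  nodup : E.Nodup

/-- The initial state. -/
def start (P E : List (ℕ × ℕ)) (k : ℕ) : State := ⟨P, E, [], [], k⟩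

section

variable {n : ℕ} {P E : List (ℕ × ℕ)} {k : ℕ} {Y : ℕ → Bool} {s : State}

theorem Reachable.next (h : Reachable P E k Y s) : Reachable P E k Y (s.next (edgeState Y)) := by
  by_cases hr : s.Running
  · have hp := State.unprobed_perm hr
    cases hX : edgeState Y s.pick.1
    · rw [State.next_of_inactive hr hX]
      refine ⟨h.probs, ?_, h.active, ?_, h.need⟩
      · refine List.Perm.trans ?_ h.perm
        refine List.perm_middle.trans ?_
        rw [← List.cons_append, ← List.cons_append]
        exact (hp.symm.append_right _).append_right _
      · intro e he
        rcases List.mem_cons.1 he with rfl | he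
        · exact hX
        · exact h.inactive e he
    · rw [State.next_of_active hr hX]
      refine ⟨h.probs, ?_, ?_, h.inactive, ?_⟩
      · refine List.Perm.trans ?_ h.perm
        refine List.Perm.append_right _ (List.perm_middle.trans ?_)
        rw [← List.cons_append]
        exact hp.symm.append_right _
      · intro e he
        rcases List.mem_cons.1 he with rfl | he
        · exact hX
        · exact h.active e he
      · have := h.need
        have := hr.2
        rw [List.length_cons]
        dsimp only
        omega
  · rwa [State.next_of_not_running hr]

theorem reachable_run (i : ℕ) : Reachable P E k Y (run Y (start P E k) i) := by
  induction i with
  | zero => exact ⟨rfl, by simp [run, start], by simp [run, start], by simp [run, start], rfl⟩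
  | succ i ih => rw [run_succ]; exact ih.next

namespace Reachable

theorem probsPos (h : Reachable P E k Y s) (hw : Wf n P E) : s.ProbsPos := by
  intro v
  rw [h.probs]
  exact hw.den_pos v

theorem mem_of_unprobed (h : Reachable P E k Y s) {e : ℕ × ℕ} (he : e ∈ s.unprobed) : e ∈ E :=
  h.perm.mem_iff.1 (by simp [he])

theorem incid_inactive (h : Reachable P E k Y s) {v : ℕ} (hv : Y v = true) :
    incid s.inactive v = 0 := by
  by_contra h0
  obtain ⟨e, he, hev⟩ := incid_pos.1 (Nat.pos_of_ne_zero h0)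
  have := h.inactive e he
  rcases hev with rfl | rfl <;> simp [edgeState, hv] at this

theorem lead_lt (h : Reachable P E k Y s) (hw : Wf n P E) (hr : s.Running) : s.lead < n := by
  have := hw.lt _ (h.mem_of_unprobed (State.pick_mem hr))
  rcases s.lead_eq with h' | h' <;> omega

end Reachable

/-! ### Few probes are not seeds -/

/-- The hot vertices. -/
def hotSet (n : ℕ) (s : State) : Finset ℕ := (Finset.range n).filter s.Hot

theorem hotSet_card_next (hw : Wf n P E) (h : Reachable P E k Y s) (hr : s.Running) :
    1 + (hotSet n (s.next (edgeState Y))).card + 2 * s.active.length ≤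
      (hotSet n s).card + (if s.Seed then 1 else 0) +
        2 * (s.next (edgeState Y)).active.length := by
  have hlt := h.lead_lt hw hr
  cases hX : edgeState Y s.pick.1
  · rw [State.next_of_inactive hr hX]
    have hsub : hotSet n ⟨s.probs, s.pick.2.unprobed, s.active, s.pick.1 :: s.inactive, s.need⟩ ⊆
        (hotSet n s).erase s.lead := by
      intro v hv
      simp only [hotSet, Finset.mem_filter, Finset.mem_range, State.Hot, incid_cons,
        Finset.mem_erase] at hv ⊢
      refine ⟨?_, hv.1, hv.2.1, by omega⟩
      rintro rfl
      have := hv.2.2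
      rw [if_pos s.lead_eq] at this
      omega
    have hc := Finset.card_le_card hsub
    dsimp only
    split
    · have := Finset.card_le_card (Finset.erase_subset s.lead (hotSet n s))
      omega
    · rename_i hs
      have hm : s.lead ∈ hotSet n s := by
        simp only [hotSet, Finset.mem_filter, Finset.mem_range]
        exact ⟨hlt, by_contra fun h' => hs ⟨hr, h'⟩⟩
      rw [Finset.card_erase_of_mem hm] at hc
      have := Finset.card_pos.2 ⟨_, hm⟩
      omega
  · rw [State.next_of_active hr hX]
    have hsub : hotSet n ⟨s.probs, s.pick.2.unprobed, s.pick.1 :: s.active, s.inactive,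
        s.need - 1⟩ ⊆ insert s.pick.1.1 (insert s.pick.1.2 (hotSet n s)) := by
      intro v hv
      simp only [hotSet, Finset.mem_filter, Finset.mem_range, State.Hot, incid_cons,
        Finset.mem_insert] at hv ⊢
      by_cases hv' : s.pick.1.1 = v ∨ s.pick.1.2 = v
      · rcases hv' with rfl | rfl <;> simp
      · rw [if_neg hv'] at hv
        exact Or.inr (Or.inr hv)
    have hc := Finset.card_le_card hsub
    rw [List.length_cons]
    split
    · have h1 := Finset.card_insert_le s.pick.1.1 (insert s.pick.1.2 (hotSet n s))
      have h2 := Finset.card_insert_le s.pick.1.2 (hotSet n s)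
      omega
    · rename_i hs
      have hm : s.lead ∈ hotSet n s := by
        simp only [hotSet, Finset.mem_filter, Finset.mem_range]
        exact ⟨hlt, by_contra fun h' => hs ⟨hr, h'⟩⟩
      rcases s.lead_eq with h' | h'
      · rw [← h'] at hm
        rw [Finset.insert_comm, Finset.insert_eq_of_mem hm] at hc
        have h2 := Finset.card_insert_le s.pick.1.2 (hotSet n s)
        omega
      · rw [← h'] at hm
        rw [Finset.insert_eq_of_mem hm] at hc
        have h2 := Finset.card_insert_le s.pick.1.1 (hotSet n s)
        omega

theorem not_running_run {i j : ℕ} (hij : i ≤ j) (h : ¬ (run Y s i).Running) :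
    run Y s j = run Y s i := by
  induction j, hij using Nat.le_induction with
  | base => rfl
  | succ j _ ih => rw [run_succ, ih, State.next_of_not_running h]

/-- A probe that is not a seed either finds an active edge or removes a hot vertex.  An active seed
creates at most two hot vertices, and any other active edge at most one, as one of its endpoints is
hot already. -/
theorem add_card_hotSet_le (hw : Wf n P E) (i : ℕ) (hr : (run Y (start P E k) i).Running) :
    i + (hotSet n (run Y (start P E k) i)).card ≤
      seeds Y (start P E k) i + 2 * (run Y (start P E k) i).active.length := by
  induction i with
  | zero =>
    have : hotSet n (run Y (start P E k) 0) = ∅ :=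
      Finset.filter_eq_empty_iff.2 fun v _ h => absurd h.1 (by simp [run, start, incid])
    simp [this]
  | succ i ih =>
    have hri : (run Y (start P E k) i).Running := by
      by_contra h
      rw [not_running_run i.le_succ h] at hr
      exact h hr
    have h1 := ih hri
    have h2 := hotSet_card_next hw (reachable_run (k := k) (Y := Y) i) hri
    rw [run_succ, seeds_succ]
    omega

/-- The last active edge is not charged for hot vertices, hence `k - 1` instead of `k`. -/
theorem sum_running_le (hw : Wf n P E) (i : ℕ) :
    (∑ j ∈ Finset.range i, if (run Y (start P E k) j).Running then 1 else 0) ≤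
      seeds Y (start P E k) i + 2 * (k - 1) := by
  induction i with
  | zero => simp
  | succ i ih =>
    rw [Finset.sum_range_succ, seeds_succ]
    split
    · rename_i hr
      have h1 := add_card_hotSet_le hw i hr
      have h2 := (reachable_run (P := P) (E := E) (k := k) (Y := Y) i).need
      have h3 := hr.2
      have h4 : (∑ j ∈ Finset.range i, if (run Y (start P E k) j).Running then 1 else 0) ≤ i := by
        refine (Finset.sum_le_card_nsmul _ _ 1 fun j _ => ?_).trans (by simp)
        split <;> simp
      split
      · omega
      · rename_i hs
        have hm : (run Y (start P E k) i).lead ∈ hotSet n (run Y (start P E k) i) := by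
          simp only [hotSet, Finset.mem_filter, Finset.mem_range]
          exact ⟨(reachable_run i).lead_lt hw hr, by_contra fun h' => hs ⟨hr, h'⟩⟩
        have := Finset.card_pos.2 ⟨_, hm⟩
        omega
    · omega

/-! ### The gain of the seeds -/

/-- The number of active edges that a seed is certain to bring, itself included, before the next
one.  When the leading vertex has value `1`, its unprobed edges are all active, and it stays hot
until all of them have been probed or no more active edges are needed. -/
def gain (Y : ℕ → Bool) (s : State) : ℕ :=
  if Y s.lead = true then min s.need (incid s.unprobed s.lead) else 0

theorem gain_le_need : gain Y s ≤ s.need := by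
  unfold gain
  split
  · exact min_le_left _ _
  · exact Nat.zero_le _

theorem harmonic_mono {a b : ℕ} (h : a ≤ b) : harmonic a ≤ harmonic b := by
  unfold harmonic
  exact Finset.sum_le_sum_of_subset_of_nonneg (Finset.range_mono h) fun i _ _ => by positivity

/-- Each of the `g` last terms of the harmonic number of `a` is at least `1 / a`. -/
theorem div_le_harmonic_sub {a g : ℕ} (h : g ≤ a) :
    (g : ℚ) / a ≤ harmonic a - harmonic (a - g) := by
  induction g with
  | zero => simp
  | succ g ih =>
    have h1 := ih (by omega)
    obtain ⟨b, hb⟩ : ∃ b, a - g = b + 1 := ⟨a - g - 1, by omega⟩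
    have hb' : a - (g + 1) = b := by omega
    rw [hb, harmonic_succ] at h1
    rw [hb', Nat.cast_succ, add_div]
    have h2 : (1 : ℚ) / a ≤ ((b + 1 : ℕ) : ℚ)⁻¹ := by
      rw [one_div]
      have : ((b + 1 : ℕ) : ℚ) ≤ a := by exact_mod_cast (by omega : b + 1 ≤ a)
      exact inv_anti₀ (by positivity) this
    linarith

/-- The invariant behind `sum_gain_le`: `K` is the need that remains once the gain of the last seed
has been collected; as long as this is not the case, some vertex of value `1` is hot and provides
what is missing. -/
theorem sum_gain_le_aux (hw : Wf n P E) (i : ℕ) : ∃ K : ℕ,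
    (∑ j ∈ Finset.range i, if (run Y (start P E k) j).Seed then
      (gain Y (run Y (start P E k) j) : ℚ) / (run Y (start P E k) j).need else 0) ≤
        harmonic k - harmonic K ∧
    ((run Y (start P E k) i).need ≤ K ∨ ∃ v, Y v = true ∧
      0 < incid (run Y (start P E k) i).active v ∧
      (run Y (start P E k) i).need ≤ K + incid (run Y (start P E k) i).unprobed v) := by
  induction i with
  | zero => exact ⟨k, by simp, Or.inl le_rfl⟩
  | succ i ih =>
    obtain ⟨K, hK, h⟩ := ih
    have hreach := reachable_run (P := P) (E := E) (k := k) (Y := Y) i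
    rw [Finset.sum_range_succ, run_succ]
    generalize run Y (start P E k) i = s at *
    by_cases hs : s.Seed
    · rw [if_pos hs]
      have hK' : s.need ≤ K := by
        rcases h with h | ⟨v, hv, hva, hvK⟩
        · exact h
        · rcases Nat.eq_zero_or_pos (incid s.unprobed v) with h0 | h0
          · omega
          · obtain ⟨e, he, hev⟩ := incid_pos.1 h0
            exact absurd ⟨hva, hreach.incid_inactive hv⟩
              (hs.not_hot (hreach.probsPos hw) he hev)
      refine ⟨s.need - gain Y s, ?_, ?_⟩
      · have h1 := div_le_harmonic_sub (gain_le_need (Y := Y) (s := s))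
        have h2 := harmonic_mono hK'
        linarith
      · have hin := State.incid_unprobed hs.1 s.lead
        rw [if_pos s.lead_eq] at hin
        have hneed := hs.1.2
        by_cases hY : Y s.lead = true
        · have hX : edgeState Y s.pick.1 = true := by
            rcases s.lead_eq with h' | h' <;> simp [edgeState, h', hY]
          refine Or.inr ⟨s.lead, hY, ?_⟩
          rw [State.next_of_active hs.1 hX, incid_cons, if_pos s.lead_eq, gain, if_pos hY]
          dsimp only
          omega
        · left
          rw [gain, if_neg hY]
          cases hX : edgeState Y s.pick.1
          · rw [State.next_of_inactive hs.1 hX]; dsimp only; omega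
          · rw [State.next_of_active hs.1 hX]; dsimp only; omega
    · rw [if_neg hs, add_zero]
      refine ⟨K, hK, ?_⟩
      by_cases hr : s.Running
      · rcases h with h | ⟨v, hv, hva, hvK⟩
        · left
          cases hX : edgeState Y s.pick.1
          · rw [State.next_of_inactive hr hX]; exact h
          · rw [State.next_of_active hr hX]; dsimp only; omega
        · right
          have hin := State.incid_unprobed hr v
          have hneed := hr.2
          refine ⟨v, hv, ?_⟩
          cases hX : edgeState Y s.pick.1
          · have : ¬ (s.pick.1.1 = v ∨ s.pick.1.2 = v) := by
              rintro (rfl | rfl) <;> simp [edgeState, hv] at hX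
            rw [if_neg this] at hin
            rw [State.next_of_inactive hr hX]
            dsimp only
            omega
          · rw [State.next_of_active hr hX, incid_cons]
            dsimp only
            split at hin <;> omega
      · rw [State.next_of_not_running hr]
        exact h

/-- Along every run, the gains of the seeds relative to the current needs add up to at most the
harmonic number of the initial need. -/
theorem sum_gain_le (hw : Wf n P E) (i : ℕ) :
    (∑ j ∈ Finset.range i, if (run Y (start P E k) j).Seed then
      (gain Y (run Y (start P E k) j) : ℚ) / (run Y (start P E k) j).need else 0) ≤
        harmonic k := by
  obtain ⟨K, hK, -⟩ := sum_gain_le_aux (Y := Y) (k := k) hw i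
  have : 0 ≤ harmonic K := Finset.sum_nonneg fun i _ => by positivity
  linarith

/-! ### Independence of the fresh vertices -/

theorem State.Fresh.of_next {X : ℕ × ℕ → Bool} {v : ℕ} (h : (s.next X).Fresh v) :
    s.Fresh v ∧ (s.Running → ¬ (s.pick.1.1 = v ∨ s.pick.1.2 = v)) := by
  by_cases hr : s.Running
  · cases hX : X s.pick.1
    · rw [State.next_of_inactive hr hX, State.Fresh, incid_cons] at h
      dsimp only at h
      refine ⟨⟨h.1, by omega⟩, fun _ hv => ?_⟩
      rw [if_pos hv] at h
      omega
    · rw [State.next_of_active hr hX, State.Fresh, incid_cons] at h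
      dsimp only at h
      refine ⟨⟨by omega, h.2⟩, fun _ hv => ?_⟩
      rw [if_pos hv] at h
      omega
  · rw [State.next_of_not_running hr] at h
    exact ⟨h, fun h' => absurd h' hr⟩

/-- The algorithm cannot know the values of fresh vertices. -/
theorem run_congr {Y' : ℕ → Bool} {v : ℕ} (hY : ∀ u, u ≠ v → Y' u = Y u) {i : ℕ}
    (h : (run Y s i).Fresh v) : run Y' s i = run Y s i ∧ seeds Y' s i = seeds Y s i := by
  induction i with
  | zero => exact ⟨rfl, by simp [seeds]⟩
  | succ i ih =>
    rw [run_succ] at h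
    obtain ⟨h1, h2⟩ := h.of_next
    obtain ⟨h3, h4⟩ := ih h1
    rw [run_succ, run_succ, seeds_succ, seeds_succ, h3, h4]
    refine ⟨?_, rfl⟩
    by_cases hr : (run Y s i).Running
    · have hv := not_or.1 (h2 hr)
      have : edgeState Y' (run Y s i).pick.1 = edgeState Y (run Y s i).pick.1 := by
        rw [edgeState, edgeState, hY _ hv.1, hY _ hv.2]
      rw [State.next, State.next, this]
    · rw [State.next_of_not_running hr, State.next_of_not_running hr]

/-! ### What other policies can gain -/

/-- Truncating the summands at `a` does not bring the sum below `a`. -/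
theorem le_sum_min {ι : Type} (V : Finset ι) (d : ι → ℕ) {a : ℕ} (h : a ≤ ∑ v ∈ V, d v) :
    a ≤ ∑ v ∈ V, min a (d v) := by
  by_cases h' : ∃ v ∈ V, a ≤ d v
  · obtain ⟨v, hv, hd⟩ := h'
    calc a = min a (d v) := (min_eq_left hd).symm
      _ ≤ _ := Finset.single_le_sum (f := fun v => min a (d v)) (fun _ _ => Nat.zero_le _) hv
  · push Not at h'
    refine h.trans (Finset.sum_le_sum fun v hv => ?_)
    rw [min_eq_right (h' v hv).le]

/-- Suppose that `k` active edges are given.  At a seed, at least as many of them as are needed have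
not been found yet, and each of these has a fresh endpoint of value `1`: an endpoint of value `1`
has no inactive edge, and no endpoint of an unprobed edge is hot. -/
theorem need_le_sum (hw : Wf n P E) (h : Reachable P E k Y s) (hs : s.Seed)
    {F : Finset (ℕ × ℕ)} (hF : ∀ e ∈ F, e ∈ E ∧ edgeState Y e = true) (hk : k ≤ F.card) :
    s.need ≤ ∑ v ∈ (Finset.range n).filter
      fun v => s.Fresh v ∧ Y v = true ∧ ∃ e ∈ F, e.1 = v ∨ e.2 = v,
        min s.need (incid s.unprobed v) := by
  refine le_sum_min _ _ ?_
  have hnd : s.unprobed.Nodup := by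
    have := h.perm.nodup_iff.2 hw.nodup
    exact ((List.nodup_append.1 (List.nodup_append.1 this).1).1)
  -- the given edges that have not been probed
  have h1 : s.need ≤ (F.filter fun e => e ∈ s.unprobed).card := by
    have h2 : F ⊆ (F.filter fun e => e ∈ s.unprobed) ∪ s.active.toFinset := by
      intro e he
      obtain ⟨heE, heY⟩ := hF e he
      have := h.perm.mem_iff.2 heE
      simp only [List.mem_append] at this
      simp only [Finset.mem_union, Finset.mem_filter, List.mem_toFinset]
      rcases this with (h3 | h3) | h3
      · exact Or.inl ⟨he, h3⟩
      · exact Or.inr h3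
      · rw [h.inactive e h3] at heY
        exact absurd heY (by simp)
    have h3 := (Finset.card_le_card h2).trans (Finset.card_union_le _ _)
    have h4 := List.toFinset_card_le s.active
    have h5 := h.need
    omega
  refine h1.trans ?_
  set V := (Finset.range n).filter
      fun v => s.Fresh v ∧ Y v = true ∧ ∃ e ∈ F, e.1 = v ∨ e.2 = v
  have h2 : (F.filter fun e => e ∈ s.unprobed) ⊆
      V.biUnion fun v => (s.unprobed.filter fun e => e.1 = v ∨ e.2 = v).toFinset := by
    intro e he
    rw [Finset.mem_filter] at he
    obtain ⟨heE, heY⟩ := hF e he.1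
    have hlt := hw.lt e heE
    obtain ⟨v, hv, hYv⟩ : ∃ v, (e.1 = v ∨ e.2 = v) ∧ Y v = true := by
      simp only [edgeState, Bool.or_eq_true] at heY
      rcases heY with h' | h'
      · exact ⟨_, Or.inl rfl, h'⟩
      · exact ⟨_, Or.inr rfl, h'⟩
    have hnot := hs.not_hot (h.probsPos hw) he.2 hv
    have h0 := h.incid_inactive hYv
    simp only [Finset.mem_biUnion, List.mem_toFinset, List.mem_filter, decide_eq_true_eq]
    refine ⟨v, ?_, he.2, hv⟩
    simp only [V, Finset.mem_filter, Finset.mem_range]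
    refine ⟨by rcases hv with rfl | rfl <;> omega, ⟨?_, h0⟩, hYv, e, he.1, hv⟩
    by_contra h3
    exact hnot ⟨Nat.pos_of_ne_zero h3, h0⟩
  refine (Finset.card_le_card h2).trans (Finset.card_biUnion_le.trans ?_)
  refine Finset.sum_le_sum fun v _ => ?_
  rw [incid, List.countP_eq_length_filter]
  exact List.toFinset_card_le _

end

namespace Input

variable {I : Input}

/-! ### Instances as lists -/

/-- The vertex outcome, extended by zero to all natural numbers. -/
def ext (Y : I.Outcome) (i : ℕ) : Bool := if h : i < I.n then Y ⟨i, h⟩ else false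

theorem ext_val (Y : I.Outcome) (v : Fin I.n) : ext Y v = Y v := dif_pos v.2

/-- The probabilities in the encoding of an instance. -/
def probList (I : Input) : List (ℕ × ℕ) :=
  (List.finRange I.n).map fun v => ((I.p v).num.toNat, (I.p v).den)

open Classical in
/-- The edges in the encoding of an instance. -/
noncomputable def edgeList (I : Input) : List (ℕ × ℕ) :=
  ((List.finRange I.n ×ˢ List.finRange I.n).filter
    fun e => decide (e.1 < e.2 ∧ I.G.Adj e.1 e.2)).map fun e => ((e.1 : ℕ), (e.2 : ℕ))

theorem encode_eq (I : Input) : I.encode = enc (I.probList, I.edgeList, I.k) := by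
  simp only [encode, enc, probList, edgeList, List.map_map]
  rfl

theorem getD_probList (v : Fin I.n) :
    I.probList.getD v (0, 1) = ((I.p v).num.toNat, (I.p v).den) := by
  rw [List.getD_eq_getElem _ _ (by simp [probList])]
  simp [probList]

theorem p_eq (v : Fin I.n) : (I.p v : ℝ) * (I.p v).den = (I.p v).num.toNat := by
  have h1 : (0 : ℤ) ≤ (I.p v).num := Rat.num_nonneg.2 (I.p_nonneg v)
  have h2 : (((I.p v).num.toNat : ℤ) : ℚ) = (I.p v).num := by rw [Int.toNat_of_nonneg h1]
  have h3 := Rat.mul_den_eq_num (I.p v)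
  rw [← h2] at h3
  exact_mod_cast h3

theorem mem_edgeList {e : ℕ × ℕ} : e ∈ I.edgeList ↔
    ∃ (hu : e.1 < I.n) (hv : e.2 < I.n), e.1 < e.2 ∧ I.G.Adj ⟨e.1, hu⟩ ⟨e.2, hv⟩ := by
  simp only [edgeList, List.mem_map, List.mem_filter, decide_eq_true_eq]
  constructor
  · rintro ⟨⟨u, v⟩, ⟨-, h1, h2⟩, rfl⟩
    exact ⟨u.2, v.2, h1, h2⟩
  · rintro ⟨hu, hv, h1, h2⟩
    exact ⟨(⟨e.1, hu⟩, ⟨e.2, hv⟩), ⟨by simp, h1, h2⟩, rfl⟩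

theorem wf (I : Input) : Wf I.n I.probList I.edgeList where
  den_pos v := by
    rcases lt_or_ge v I.n with h | h
    · rw [getD_probList ⟨v, h⟩]
      exact (I.p _).den_pos
    · rw [List.getD_eq_default _ _ (by simpa [probList] using h)]
      simp
  lt e he := by
    obtain ⟨hu, hv, h1, -⟩ := mem_edgeList.1 he
    exact ⟨h1, hv⟩
  nodup := by
    refine List.Nodup.map ?_ (List.Nodup.filter _
      ((List.nodup_finRange _).product (List.nodup_finRange _)))
    intro a b hab
    simp only [Prod.mk.injEq] at hab
    exact Prod.ext (Fin.ext hab.1) (Fin.ext hab.2)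

theorem nonempty_edge (I : Input) : Nonempty I.Edge := by
  have h := I.one_le_k.trans I.k_le
  exact (Set.nonempty_of_ncard_ne_zero (by omega)).to_subtype

open Classical in
/-- The edge named by a pair of vertices. -/
noncomputable def toEdge (I : Input) (e : ℕ × ℕ) : I.Edge :=
  if h : ∃ (hu : e.1 < I.n) (hv : e.2 < I.n), I.G.Adj ⟨e.1, hu⟩ ⟨e.2, hv⟩ then
    ⟨s(⟨e.1, h.choose⟩, ⟨e.2, h.choose_spec.choose⟩), h.choose_spec.choose_spec⟩
  else I.nonempty_edge.some

theorem toEdge_eq {e : ℕ × ℕ} (he : e ∈ I.edgeList) :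
    ∃ (hu : e.1 < I.n) (hv : e.2 < I.n),
      (I.toEdge e : Sym2 (Fin I.n)) = s(⟨e.1, hu⟩, ⟨e.2, hv⟩) := by
  obtain ⟨hu, hv, -, h⟩ := mem_edgeList.1 he
  refine ⟨hu, hv, ?_⟩
  rw [toEdge, dif_pos ⟨hu, hv, h⟩]

theorem X_toEdge (Y : I.Outcome) {e : ℕ × ℕ} (he : e ∈ I.edgeList) :
    I.X Y (I.toEdge e) = edgeState (ext Y) e := by
  obtain ⟨hu, hv, h⟩ := toEdge_eq he
  rw [X, h, Sym2.lift_mk, edgeState, ext, ext, dif_pos hu, dif_pos hv]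

theorem oracle_enc (Y : I.Outcome) {e : ℕ × ℕ} (he : e ∈ I.edgeList) :
    I.oracle Y (enc e) = some (I.toEdge e, edgeState (ext Y) e) := by
  obtain ⟨hu, hv, -, h⟩ := mem_edgeList.1 he
  have h' : ∃ (hu : e.1 < I.n) (hv : e.2 < I.n), I.G.Adj ⟨e.1, hu⟩ ⟨e.2, hv⟩ := ⟨hu, hv, h⟩
  rw [← X_toEdge Y he, toEdge, dif_pos h']
  exact dif_pos h'

theorem toEdge_injOn : Set.InjOn I.toEdge {e | e ∈ I.edgeList} := by
  intro e he e' he' h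
  obtain ⟨hu, hv, h1⟩ := toEdge_eq he
  obtain ⟨hu', hv', h1'⟩ := toEdge_eq he'
  have h2 := (I.wf.lt e he).1
  have h2' := (I.wf.lt e' he').1
  rw [h, h1', Sym2.eq_iff] at h1
  simp only [Fin.mk.injEq] at h1
  exact Prod.ext (by omega) (by omega)

theorem exists_toEdge (f : I.Edge) : ∃ e ∈ I.edgeList, I.toEdge e = f := by
  obtain ⟨f, hf⟩ := f
  induction f with
  | h u v =>
    rw [SimpleGraph.mem_edgeSet] at hf
    rcases lt_trichotomy u v with h | h | h
    · have he : ((u : ℕ), (v : ℕ)) ∈ I.edgeList := mem_edgeList.2 ⟨u.2, v.2, h, hf⟩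
      obtain ⟨_, _, h'⟩ := toEdge_eq he
      exact ⟨_, he, Subtype.ext h'⟩
    · exact absurd h hf.ne
    · have he : ((v : ℕ), (u : ℕ)) ∈ I.edgeList := mem_edgeList.2 ⟨v.2, u.2, h, hf.symm⟩
      obtain ⟨_, _, h'⟩ := toEdge_eq he
      exact ⟨_, he, Subtype.ext (h'.trans Sym2.eq_swap)⟩

theorem length_edgeList_le {l : List I.Edge} (h : ∀ e, e ∈ l) : I.edgeList.length ≤ l.length := by
  have hnd : (I.edgeList.map I.toEdge).Nodup :=
    List.Nodup.map_on (fun _ h₁ _ h₂ h => toEdge_injOn h₁ h₂ h) I.wf.nodup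
  rw [← List.length_map (f := I.toEdge)]
  exact (hnd.subperm fun e _ => h e).length_le

theorem ncard_mem_le (l : List I.Edge) (q : I.Edge → Prop) :
    {e : I.Edge | e ∈ l ∧ q e}.ncard ≤ l.length := by
  classical
  refine le_trans ?_ (List.toFinset_card_le l)
  rw [← Set.ncard_coe_finset]
  exact Set.ncard_le_ncard fun e he => by simpa using he.1

theorem k_le_length {Y : I.Outcome} {l : List I.Edge} (h : I.Done Y l) : I.k ≤ l.length := by
  rcases h with h | h
  · exact h.trans (ncard_mem_le l _)
  · refine I.k_le.trans ?_
    rw [← Nat.card_coe_set_eq, ← Set.ncard_univ]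
    refine le_trans (Set.ncard_le_ncard ?_) (ncard_mem_le l fun _ => True)
    exact fun e _ => ⟨h e, trivial⟩

/-! ### Expectations -/

/-- The probability of an outcome. -/
noncomputable def weight (I : Input) (Y : I.Outcome) : ℝ :=
  ∏ v, if Y v = true then (I.p v : ℝ) else 1 - (I.p v : ℝ)

theorem weight_nonneg (Y : I.Outcome) : 0 ≤ I.weight Y := by
  refine Finset.prod_nonneg fun v _ => ?_
  have h0 : (0 : ℝ) ≤ I.p v := by exact_mod_cast I.p_nonneg v
  have h1 : (I.p v : ℝ) ≤ 1 := by exact_mod_cast I.p_le_one v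
  split <;> linarith

theorem expect_mono {f g : I.Outcome → ℝ} (h : ∀ Y, f Y ≤ g Y) : I.expect f ≤ I.expect g :=
  Finset.sum_le_sum fun Y _ => mul_le_mul_of_nonneg_left (h Y) (weight_nonneg Y)

theorem expect_sum {ι : Type} (S : Finset ι) (f : ι → I.Outcome → ℝ) :
    I.expect (fun Y => ∑ i ∈ S, f i Y) = ∑ i ∈ S, I.expect (f i) := by
  simp only [expect, Finset.mul_sum]
  exact Finset.sum_comm

theorem expect_const_mul (c : ℝ) (f : I.Outcome → ℝ) :
    I.expect (fun Y => c * f Y) = c * I.expect f := by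
  simp only [expect, Finset.mul_sum]
  exact Finset.sum_congr rfl fun Y _ => by ring

theorem expect_add (f g : I.Outcome → ℝ) :
    I.expect (fun Y => f Y + g Y) = I.expect f + I.expect g := by
  simp only [expect, mul_add, Finset.sum_add_distrib]

/-- The outcome with the value of the vertex `v` changed. -/
def flip (v : Fin I.n) (Y : I.Outcome) : I.Outcome := Function.update Y v (!Y v)

theorem flip_flip (v : Fin I.n) (Y : I.Outcome) : flip v (flip v Y) = Y := by
  simp [flip]

/-- If `f` does not depend on the value of `v`, then it is independent of it. -/
theorem expect_ite_of_invariant (v : Fin I.n) (f : I.Outcome → ℝ)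
    (hf : ∀ Y, f (flip v Y) = f Y) :
    I.expect (fun Y => if Y v = true then f Y else 0) = I.p v * I.expect f := by
  -- the probability of the values of the other vertices
  let R : I.Outcome → ℝ := fun Y =>
    ∏ u ∈ Finset.univ.erase v, if Y u = true then (I.p u : ℝ) else 1 - (I.p u : ℝ)
  have hW : ∀ Y : I.Outcome,
      (∏ u, if Y u = true then (I.p u : ℝ) else 1 - (I.p u : ℝ)) =
        (if Y v = true then (I.p v : ℝ) else 1 - (I.p v : ℝ)) * R Y :=
    fun Y => (Finset.mul_prod_erase _ _ (Finset.mem_univ v)).symm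
  have hR : ∀ Y, R (flip v Y) = R Y := fun Y => by
    refine Finset.prod_congr rfl fun u hu => ?_
    rw [flip, Function.update_of_ne (Finset.ne_of_mem_erase hu)]
  have hswap : ∑ Y : I.Outcome, (if Y v = true then 0 else R Y * f Y) =
      ∑ Y : I.Outcome, (if Y v = true then R Y * f Y else 0) := by
    refine Finset.sum_bij' (fun Y _ => flip v Y) (fun Y _ => flip v Y) (by simp) (by simp)
      (fun Y _ => flip_flip v Y) (fun Y _ => flip_flip v Y) fun Y _ => ?_
    rw [hR, hf]
    cases h : Y v <;> simp [flip, h]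
  have h1 : I.expect (fun Y => if Y v = true then f Y else 0) =
      I.p v * ∑ Y : I.Outcome, (if Y v = true then R Y * f Y else 0) := by
    rw [expect, Finset.mul_sum]
    refine Finset.sum_congr rfl fun Y _ => ?_
    rw [hW]
    split <;> ring
  have h2 : I.expect f = I.p v * ∑ Y : I.Outcome, (if Y v = true then R Y * f Y else 0) +
      (1 - I.p v) * ∑ Y : I.Outcome, (if Y v = true then 0 else R Y * f Y) := by
    rw [expect, Finset.mul_sum, Finset.mul_sum, ← Finset.sum_add_distrib]
    refine Finset.sum_congr rfl fun Y _ => ?_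
    rw [hW]
    split <;> ring
  rw [h1, h2, hswap]
  ring

theorem ext_flip (v : Fin I.n) (Y : I.Outcome) {u : ℕ} (hu : u ≠ v) :
    ext (flip v Y) u = ext Y u := by
  unfold ext flip
  split
  · rw [Function.update_of_ne]
    exact fun h => hu (congrArg Fin.val h)
  · rfl

/-! ### Policies -/

theorem X_flip (v : Fin I.n) (Y : I.Outcome) {f : I.Edge} (hf : v ∉ (f : Sym2 (Fin I.n))) :
    I.X (flip v Y) f = I.X Y f := by
  obtain ⟨f, hE⟩ := f
  induction f with
  | h a b =>
    simp only [Sym2.mem_iff, not_or] at hf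
    simp [X, flip, Function.update_of_ne (Ne.symm hf.1), Function.update_of_ne (Ne.symm hf.2)]

/-- Among the first `t` probes of `π` is one of an edge at `v`. -/
def Touches (π : Policy I.Edge) (t : ℕ) (v : Fin I.n) (Y : I.Outcome) : Prop :=
  ∃ f ∈ (π.probes (I.X Y)).take t, v ∈ (f : Sym2 (Fin I.n))

/-- Whether a policy probes an element with property `q` does not depend on the states of these
elements: up to the first such probe, it has seen none of them. -/
theorem exists_mem_take_probes {ε : Type} {X X' : ε → Bool} {q : ε → Prop}
    (h : ∀ e, ¬ q e → X' e = X e) (π : Policy ε) (t : ℕ)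
    (hq : ∃ e ∈ (π.probes X).take t, q e) : ∃ e ∈ (π.probes X').take t, q e := by
  induction π generalizing t with
  | halt => simp [Policy.probes] at hq
  | probe e π₀ π₁ ih₀ ih₁ =>
    rcases t with _ | t
    · simp at hq
    · rw [Policy.probes, List.take_succ_cons] at hq ⊢
      by_cases he : q e
      · exact ⟨e, by simp, he⟩
      · obtain ⟨f, hf, hqf⟩ := hq
        rcases List.mem_cons.1 hf with rfl | hf
        · exact absurd hqf he
        · rw [h e he]
          have : ∃ f ∈ (if X e = true then π₁.probes X' else π₀.probes X').take t, q f := by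
            split at hf
            · rename_i hX; rw [if_pos hX]; exact ih₁ t ⟨f, hf, hqf⟩
            · rename_i hX; rw [if_neg hX]; exact ih₀ t ⟨f, hf, hqf⟩
          obtain ⟨g, hg, hqg⟩ := this
          exact ⟨g, List.mem_cons_of_mem _ hg, hqg⟩

/-- Whether a policy touches a vertex does not depend on the value of this vertex. -/
theorem touches_flip (π : Policy I.Edge) (t : ℕ) (v : Fin I.n) (Y : I.Outcome) :
    Touches π t v (flip v Y) ↔ Touches π t v Y := by
  constructor
  · intro h
    exact exists_mem_take_probes (fun f hf => (X_flip v Y hf).symm) π t h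
  · intro h
    exact exists_mem_take_probes (fun f hf => X_flip v Y hf) π t h

open Classical in
theorem card_touches_le (π : Policy I.Edge) (t : ℕ) (Y : I.Outcome) :
    (Finset.univ.filter fun v => Touches π t v Y).card ≤ 2 * t := by
  have hsub : (Finset.univ.filter fun v => Touches π t v Y) ⊆
      ((π.probes (I.X Y)).take t).toFinset.biUnion
        fun f => Finset.univ.filter fun v => v ∈ (f : Sym2 (Fin I.n)) := by
    intro v hv
    obtain ⟨f, hf, hvf⟩ := (Finset.mem_filter.1 hv).2
    simp only [Finset.mem_biUnion, List.mem_toFinset, Finset.mem_filter, Finset.mem_univ, true_and]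
    exact ⟨f, hf, hvf⟩
  refine (Finset.card_le_card hsub).trans ?_
  refine (Finset.card_biUnion_le_card_mul _ _ 2 ?_).trans ?_
  · rintro ⟨f, hf⟩ -
    induction f with
    | h a b =>
      refine (Finset.card_le_card (t := {a, b}) fun v hv => ?_).trans Finset.card_le_two
      simpa [Sym2.mem_iff] using hv
  · have h1 := List.toFinset_card_le ((π.probes (I.X Y)).take t)
    have h2 := List.length_take_le t (π.probes (I.X Y))
    omega

open Classical in
/-- The active edges among the first `t` probes of `π`. -/
noncomputable def foundEdges (π : Policy I.Edge) (t : ℕ) (Y : I.Outcome) : Finset (ℕ × ℕ) :=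
  I.edgeList.toFinset.filter fun e =>
    I.toEdge e ∈ (π.probes (I.X Y)).take t ∧ edgeState (ext Y) e = true

/-- The first `t` probes of `π` find `k` active edges. -/
def Finds (π : Policy I.Edge) (t : ℕ) (Y : I.Outcome) : Prop := I.k ≤ (foundEdges π t Y).card

theorem finds_of_length_le {π : Policy I.Edge} {t : ℕ} {Y : I.Outcome}
    (ht : (π.probes (I.X Y)).length ≤ t)
    (h : I.k ≤ {e : I.Edge | e ∈ π.probes (I.X Y) ∧ I.X Y e = true}.ncard) : Finds π t Y := by
  classical
  refine h.trans ?_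
  refine le_trans ?_ (Finset.card_image_le (s := foundEdges π t Y) (f := I.toEdge))
  rw [← Set.ncard_coe_finset]
  refine Set.ncard_le_ncard fun f hf => ?_
  obtain ⟨e, he, rfl⟩ := exists_toEdge f
  have h2 := hf.2
  rw [X_toEdge Y he] at h2
  simp only [Finset.coe_image, Set.mem_image, Finset.mem_coe]
  refine ⟨e, ?_, rfl⟩
  simp only [foundEdges, Finset.mem_filter, List.mem_toFinset]
  exact ⟨he, by rw [List.take_of_length_le ht]; exact hf.1, h2⟩


/-! ### Comparison of the seeds with a policy -/

/-- The state of the algorithm after `i` rounds. -/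
noncomputable def stateAt (Y : I.Outcome) (i : ℕ) : State :=
  run (ext Y) (start I.probList I.edgeList I.k) i

/-- The number of seeds in the first `i` rounds. -/
noncomputable def seedsAt (Y : I.Outcome) (i : ℕ) : ℕ :=
  seeds (ext Y) (start I.probList I.edgeList I.k) i

theorem reachable (Y : I.Outcome) (i : ℕ) :
    Reachable I.probList I.edgeList I.k (ext Y) (stateAt Y i) := reachable_run i

theorem stateAt_flip {v : Fin I.n} {Y : I.Outcome} {i : ℕ} (h : (stateAt Y i).Fresh v) :
    stateAt (flip v Y) i = stateAt Y i ∧ seedsAt (flip v Y) i = seedsAt Y i :=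
  run_congr (fun _ hu => ext_flip v Y hu) h

/-- Let `g` be a function of the state after `i` rounds, of the number of earlier seeds and of the
outcome, which vanishes when `v` is not fresh.  If its direct dependence on the outcome ignores the
value of `v`, then so does the whole, since the algorithm cannot know this value. -/
theorem flip_invariant {v : Fin I.n} {i : ℕ} {g : State → ℕ → I.Outcome → ℝ}
    (h0 : ∀ s c Y, ¬ s.Fresh v → g s c Y = 0) (hg : ∀ s c Y, g s c (flip v Y) = g s c Y)
    (Y : I.Outcome) :
    g (stateAt (flip v Y) i) (seedsAt (flip v Y) i) (flip v Y) =
      g (stateAt Y i) (seedsAt Y i) Y := by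
  by_cases h : (stateAt Y i).Fresh v
  · obtain ⟨h1, h2⟩ := stateAt_flip h
    rw [h1, h2, hg]
  · rw [h0 _ _ _ h, h0]
    intro h'
    obtain ⟨h1, -⟩ := stateAt_flip h'
    rw [flip_flip] at h1
    rw [h1] at h
    exact h h'

/-- At a seed, no fresh vertex `v` has a larger expected gain than the leading vertex `w`, whose
expected gain counts as zero if `w` is not fresh. -/
theorem mul_min_le {s : State} {Y : ℕ → Bool} (h : Reachable I.probList I.edgeList I.k Y s)
    (hs : s.Seed) {v w : Fin I.n} (hv : s.Fresh v) (hw : s.lead = w) :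
    (I.p v : ℝ) * min s.need (incid s.unprobed v) ≤
      if s.Fresh w then (I.p w : ℝ) * min s.need (incid s.unprobed w) else 0 := by
  have hp : ∀ v : Fin I.n, (0 : ℝ) ≤ I.p v := fun v => by exact_mod_cast I.p_nonneg v
  rcases Nat.eq_zero_or_pos (incid s.unprobed v) with h0 | h0
  · rw [h0]
    simp only [Nat.cast_zero, Nat.min_zero, mul_zero]
    have := hp w
    split <;> positivity
  obtain ⟨e, he, hev⟩ := incid_pos.1 h0
  have hle := State.score_le_lead (h.probsPos I.wf) hs.1 he hev
  have hsv : s.score v = ((I.p v).num.toNat * min s.need (incid s.unprobed v), (I.p v).den) := by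
    rw [State.score, if_neg (by rw [hv.2]; simp), if_neg (by rw [hv.1]; simp), h.probs,
      getD_probList]
  have hdv : (0 : ℝ) < (I.p v).den := by exact_mod_cast (I.p v).den_pos
  rw [hw] at hle
  have hnh : ¬ s.Hot w := hw ▸ hs.2
  split
  · rename_i hf
    have hsw : s.score w = ((I.p w).num.toNat * min s.need (incid s.unprobed w), (I.p w).den) := by
      rw [State.score, if_neg (by rw [hf.2]; simp), if_neg (by rw [hf.1]; simp), h.probs,
        getD_probList]
    have hdw : (0 : ℝ) < (I.p w).den := by exact_mod_cast (I.p w).den_pos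
    rw [hsv, hsw, FracLE] at hle
    have hle' : ((I.p v).num.toNat : ℝ) * min s.need (incid s.unprobed v) * (I.p w).den ≤
        (I.p w).num.toNat * min s.need (incid s.unprobed w) * (I.p v).den := by
      exact_mod_cast hle
    rw [← p_eq, ← p_eq] at hle'
    refine le_of_mul_le_mul_right ?_ (mul_pos hdv hdw)
    push_cast at hle' ⊢
    linarith
  · rename_i hf
    have hsw : s.score w = (0, 1) := by
      rw [State.score, if_pos]
      by_contra h1
      refine hf ⟨?_, by omega⟩
      by_contra h2
      exact hnh ⟨by omega, by omega⟩
    rw [hsv, hsw, FracLE] at hle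
    have h1 : (I.p v).num.toNat * min s.need (incid s.unprobed v) = 0 := by simpa using hle
    have h2 : ((I.p v).num.toNat : ℝ) * min s.need (incid s.unprobed v) = 0 := by
      exact_mod_cast h1
    rw [← p_eq] at h2
    refine le_of_mul_le_mul_right ?_ hdv
    push_cast at h2 ⊢
    linarith

open Classical in
/-- In every round, the expected relative gain of a seed is at least the probability that `π` finds
`k` active edges by time `τ`, divided by `2 * τ`: by then `π` has touched at most `2 * τ` vertices,
each of which it touches without knowing its value, and the greedy choice is at least as good as any
of them.  The time may depend on the number of earlier seeds; here it is `(c + 1) / L` after `c`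
seeds. -/
theorem half_mul_expect_finds_le (π : Policy I.Edge) {L : ℝ} (hL : 0 < L) (i : ℕ) :
    L / 2 * I.expect (fun Y => if (stateAt Y i).Seed ∧ Finds π ⌊(seedsAt Y i + 1) / L⌋₊ Y
      then 1 else 0) ≤
    I.expect (fun Y => if (stateAt Y i).Seed then
      (seedsAt Y i + 1) * (gain (ext Y) (stateAt Y i) / (stateAt Y i).need : ℝ) else 0) := by
  have hp : ∀ v : Fin I.n, (0 : ℝ) ≤ I.p v := fun v => by exact_mod_cast I.p_nonneg v
  -- the gain from the leading vertex, if it is fresh, without the factor for its value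
  let φ : Fin I.n → State → ℕ → I.Outcome → ℝ := fun v s c _ =>
    if s.Seed ∧ s.lead = v ∧ s.Fresh v then
      (c + 1) * (min s.need (incid s.unprobed v) / s.need : ℝ) else 0
  -- the gain from the fresh vertices that `π` touches, without the factors for their values
  let ψ : Fin I.n → State → ℕ → I.Outcome → ℝ := fun v s c Y =>
    if s.Seed ∧ s.Fresh v ∧ Touches π ⌊(c + 1) / L⌋₊ v Y then
      (min s.need (incid s.unprobed v) / s.need : ℝ) else 0
  have hφ : ∀ v Y, φ v (stateAt (flip v Y) i) (seedsAt (flip v Y) i) (flip v Y) =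
      φ v (stateAt Y i) (seedsAt Y i) Y := fun v =>
    flip_invariant (fun s c Y h => if_neg fun h' => h h'.2.2) fun s c Y => rfl
  have hψ : ∀ v Y, ψ v (stateAt (flip v Y) i) (seedsAt (flip v Y) i) (flip v Y) =
      ψ v (stateAt Y i) (seedsAt Y i) Y := fun v =>
    flip_invariant (fun s c Y h => if_neg fun h' => h h'.2.1) fun s c Y => by
      simp only [ψ, touches_flip]
  have h1 : I.expect (fun Y => ∑ v, if Y v = true then φ v (stateAt Y i) (seedsAt Y i) Y else 0) ≤
      I.expect (fun Y => if (stateAt Y i).Seed then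
        (seedsAt Y i + 1) * (gain (ext Y) (stateAt Y i) / (stateAt Y i).need : ℝ) else 0) := by
    refine expect_mono fun Y => ?_
    split
    · rename_i hs
      obtain ⟨w, hw⟩ : ∃ w : Fin I.n, (stateAt Y i).lead = w :=
        ⟨⟨_, (reachable Y i).lead_lt I.wf hs.1⟩, rfl⟩
      rw [Finset.sum_eq_single w]
      · split
        · rename_i hYw
          rw [gain, hw, ext_val, if_pos hYw]
          simp only [φ]
          split
          · push_cast; exact le_rfl
          · positivity
        · positivity
      · intro v _ hv
        split
        · refine if_neg fun h => hv ?_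
          exact Fin.ext (h.2.1.symm.trans hw)
        · rfl
      · simp
    · rename_i hs
      refine (Finset.sum_eq_zero fun v _ => ?_).le
      split
      · exact if_neg fun h => hs h.1
      · rfl
  have h2 : I.expect (fun Y => if (stateAt Y i).Seed ∧ Finds π ⌊(seedsAt Y i + 1) / L⌋₊ Y
      then 1 else 0) ≤
      I.expect (fun Y => ∑ v, if Y v = true then ψ v (stateAt Y i) (seedsAt Y i) Y else 0) := by
    refine expect_mono fun Y => ?_
    have hnn : ∀ v, 0 ≤ if Y v = true then ψ v (stateAt Y i) (seedsAt Y i) Y else 0 := by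
      intro v
      simp only [ψ]
      split
      · split <;> positivity
      · exact le_rfl
    split
    · rename_i hs
      have hneed := need_le_sum I.wf (reachable Y i) hs.1 (F := foundEdges π _ Y)
        (fun e he => by
          simp only [foundEdges, Finset.mem_filter, List.mem_toFinset] at he
          exact ⟨he.1, he.2.2⟩) hs.2
      have hpos : (0 : ℝ) < (stateAt Y i).need := by
        exact_mod_cast Nat.pos_of_ne_zero hs.1.1.2
      rw [Finset.sum_filter, Finset.sum_range] at hneed
      have hneed' : ((stateAt Y i).need : ℝ) ≤ ∑ v : Fin I.n, if (stateAt Y i).Fresh v ∧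
          ext Y v = true ∧ (∃ e ∈ foundEdges π ⌊(seedsAt Y i + 1) / L⌋₊ Y, e.1 = v ∨ e.2 = v) then
          (min (stateAt Y i).need (incid (stateAt Y i).unprobed v) : ℝ) else 0 := by
        exact_mod_cast hneed
      refine le_of_mul_le_mul_right ?_ hpos
      rw [one_mul, Finset.sum_mul]
      refine hneed'.trans (Finset.sum_le_sum fun v _ => ?_)
      split
      · rename_i hv
        obtain ⟨hfr, hYv, e, he, hev⟩ := hv
        rw [ext_val] at hYv
        simp only [foundEdges, Finset.mem_filter, List.mem_toFinset] at he
        have ht : Touches π ⌊(seedsAt Y i + 1) / L⌋₊ v Y := by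
          obtain ⟨hu, hw, h⟩ := toEdge_eq he.1
          refine ⟨_, he.2.1, ?_⟩
          rw [h, Sym2.mem_iff]
          rcases hev with hev | hev
          · exact Or.inl (Fin.ext hev.symm)
          · exact Or.inr (Fin.ext hev.symm)
        rw [if_pos hYv]
        simp only [ψ]
        rw [if_pos ⟨hs.1, hfr, ht⟩, div_mul_cancel₀ _ hpos.ne', Nat.cast_min]
      · exact mul_nonneg (hnn v) hpos.le
    · exact Finset.sum_nonneg fun v _ => hnn v
  -- the values of fresh vertices are independent of everything else
  have h3 : ∀ χ : Fin I.n → State → ℕ → I.Outcome → ℝ,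
      (∀ v Y, χ v (stateAt (flip v Y) i) (seedsAt (flip v Y) i) (flip v Y) =
        χ v (stateAt Y i) (seedsAt Y i) Y) →
      I.expect (fun Y => ∑ v, if Y v = true then χ v (stateAt Y i) (seedsAt Y i) Y else 0) =
        I.expect (fun Y => ∑ v, I.p v * χ v (stateAt Y i) (seedsAt Y i) Y) := by
    intro χ hχ
    rw [expect_sum, expect_sum]
    refine Finset.sum_congr rfl fun v _ => ?_
    rw [expect_ite_of_invariant v (fun Y => χ v (stateAt Y i) (seedsAt Y i) Y) (hχ v),
      expect_const_mul]
  rw [h3 φ hφ] at h1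
  rw [h3 ψ hψ] at h2
  refine (mul_le_mul_of_nonneg_left h2 (by positivity)).trans (le_trans ?_ h1)
  rw [← expect_const_mul]
  refine expect_mono fun Y => ?_
  by_cases hs : (stateAt Y i).Seed
  · obtain ⟨w, hw⟩ : ∃ w : Fin I.n, (stateAt Y i).lead = w :=
      ⟨⟨_, (reachable Y i).lead_lt I.wf hs.1⟩, rfl⟩
    have hpos : (0 : ℝ) < (stateAt Y i).need := by exact_mod_cast Nat.pos_of_ne_zero hs.1.2
    set s := stateAt Y i with hsdef
    set c := seedsAt Y i
    set ρ : ℝ := if s.Fresh w then (I.p w : ℝ) * min s.need (incid s.unprobed w) else 0 with hρ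
    have hρ0 : 0 ≤ ρ := by
      have := hp w
      rw [hρ]
      split <;> positivity
    have h4 : ∑ v, I.p v * φ v s c Y = (c + 1) * (ρ / s.need) := by
      rw [Finset.sum_eq_single w]
      · simp only [φ, hρ]
        split
        · rename_i h
          rw [if_pos h.2.2]
          ring
        · rename_i h
          rw [if_neg fun h' => h ⟨hs, hw, h'⟩]
          ring
      · intro v _ hv
        simp only [φ]
        rw [if_neg fun h => hv (Fin.ext (h.2.1.symm.trans hw)), mul_zero]
      · simp
    have h5 : ∑ v, I.p v * ψ v s c Y ≤
        ∑ v ∈ Finset.univ.filter (fun v => Touches π ⌊(c + 1) / L⌋₊ v Y), ρ / s.need := by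
      rw [Finset.sum_filter]
      refine Finset.sum_le_sum fun v _ => ?_
      simp only [ψ]
      split
      · rename_i h
        rw [if_pos h.2.2, mul_div_assoc']
        exact div_le_div_of_nonneg_right (mul_min_le (reachable Y i) hs h.2.1 hw) hpos.le
      · rw [mul_zero]
        split <;> positivity
    rw [h4]
    rw [Finset.sum_const, nsmul_eq_mul] at h5
    have h6 : ((Finset.univ.filter fun v => Touches π ⌊(c + 1) / L⌋₊ v Y).card : ℝ) ≤
        2 * ((c + 1) / L) := by
      have h7 : (((Finset.univ.filter fun v => Touches π ⌊(c + 1) / L⌋₊ v Y).card : ℕ) : ℝ) ≤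
          2 * ⌊((c : ℝ) + 1) / L⌋₊ := by exact_mod_cast card_touches_le π _ Y
      have h8 := Nat.floor_le (show (0 : ℝ) ≤ (c + 1) / L by positivity)
      linarith
    calc L / 2 * ∑ v, I.p v * ψ v s c Y ≤ L / 2 * (2 * ((c + 1) / L) * (ρ / s.need)) := by
          refine mul_le_mul_of_nonneg_left (h5.trans ?_) (by positivity)
          exact mul_le_mul_of_nonneg_right h6 (by positivity)
      _ = (c + 1) * (ρ / s.need) := by field_simp
  · have e1 : ∀ v, φ v (stateAt Y i) (seedsAt Y i) Y = 0 := fun v => if_neg fun h => hs h.1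
    have e2 : ∀ v, ψ v (stateAt Y i) (seedsAt Y i) Y = 0 := fun v => if_neg fun h => hs h.1
    simp [e1, e2]

/-- Summation over the seeds is summation over their numbers. -/
theorem sum_seeds (Y : ℕ → Bool) (s : State) (f : ℕ → ℝ) (m : ℕ) :
    (∑ i ∈ Finset.range m, if (run Y s i).Seed then f (seeds Y s i) else 0) =
      ∑ c ∈ Finset.range (seeds Y s m), f c := by
  induction m with
  | zero => simp [seeds]
  | succ m ih =>
    rw [Finset.sum_range_succ, ih, seeds_succ]
    split
    · rw [Finset.sum_range_succ]
    · simp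

theorem seeds_mono (Y : ℕ → Bool) (s : State) {i j : ℕ} (h : i ≤ j) :
    seeds Y s i ≤ seeds Y s j :=
  Finset.sum_le_sum_of_subset (Finset.range_mono h)

theorem seeds_le (Y : ℕ → Bool) (s : State) (i : ℕ) : seeds Y s i ≤ i := by
  refine (Finset.sum_le_card_nsmul _ _ 1 fun j _ => ?_).trans (by simp)
  split <;> simp

open Classical in
/-- If `π` makes `C` probes, then all seeds except for at most `L * C` come when `π`, slowed down by
the factor `L`, has already found `k` active edges.  Outcomes with fewer than `k` active edges cause
no trouble: there `π` probes all edges, and so `C` is at least the number of all seeds. -/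
theorem seeds_sub_le {π : Policy I.Edge} {L : ℝ} (hL : 1 ≤ L) (Y : I.Outcome)
    (hπ : I.Done Y (π.probes (I.X Y))) :
    (seedsAt Y I.edgeList.length : ℝ) - L * (π.probes (I.X Y)).length ≤
      ∑ i ∈ Finset.range I.edgeList.length,
        if (stateAt Y i).Seed ∧ Finds π ⌊((seedsAt Y i : ℝ) + 1) / L⌋₊ Y then 1 else 0 := by
  have h1 := sum_seeds (ext Y) (start I.probList I.edgeList I.k)
    (fun c => if Finds π ⌊((c : ℝ) + 1) / L⌋₊ Y then (1 : ℝ) else 0) I.edgeList.length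
  have h2 : (∑ i ∈ Finset.range I.edgeList.length,
      if (stateAt Y i).Seed ∧ Finds π ⌊((seedsAt Y i : ℝ) + 1) / L⌋₊ Y then (1 : ℝ) else 0) =
      ∑ c ∈ Finset.range (seedsAt Y I.edgeList.length),
        if Finds π ⌊((c : ℝ) + 1) / L⌋₊ Y then (1 : ℝ) else 0 := by
    rw [seedsAt, ← h1]
    refine Finset.sum_congr rfl fun i _ => ?_
    rw [ite_and]
    rfl
  rw [h2]
  set N := seedsAt Y I.edgeList.length
  set C := (π.probes (I.X Y)).length
  have hL0 : 0 < L := by linarith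
  have h3 : (N : ℝ) - ∑ c ∈ Finset.range N,
    (if Finds π ⌊((c : ℝ) + 1) / L⌋₊ Y then (1 : ℝ) else 0) =
      ((Finset.range N).filter fun c : ℕ => ¬ Finds π ⌊((c : ℝ) + 1) / L⌋₊ Y).card := by
    rw [Finset.sum_boole, sub_eq_iff_eq_add, ← Nat.cast_add, add_comm,
      Finset.card_filter_add_card_filter_not, Finset.card_range]
  have h4 : ((Finset.range N).filter fun c : ℕ => ¬ Finds π ⌊((c : ℝ) + 1) / L⌋₊ Y) ⊆
      Finset.range ⌊L * C⌋₊ := by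
    intro c hc
    obtain ⟨hcN, hcF⟩ := Finset.mem_filter.1 hc
    rw [Finset.mem_range] at hcN ⊢
    rw [← Nat.succ_le_iff]
    refine Nat.le_floor ?_
    push_cast
    rcases hπ with h | h
    · by_contra hlt
      refine hcF (finds_of_length_le ?_ h)
      refine Nat.le_floor ?_
      rw [le_div_iff₀ hL0]
      push Not at hlt
      change (C : ℝ) * L ≤ _
      linarith
    · have h5 : N ≤ I.edgeList.length := seeds_le _ _ _
      have h6 : I.edgeList.length ≤ C := length_edgeList_le h
      have h7 : ((c : ℝ) + 1) ≤ C := by exact_mod_cast (by omega : c + 1 ≤ C)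
      have h8 : (0 : ℝ) ≤ C := Nat.cast_nonneg _
      nlinarith
  have h5 := Finset.card_le_card h4
  rw [Finset.card_range] at h5
  have h6 : (⌊L * C⌋₊ : ℝ) ≤ L * C := Nat.floor_le (by positivity)
  have h7 : (((Finset.range N).filter fun c : ℕ => ¬ Finds π ⌊((c : ℝ) + 1) / L⌋₊ Y).card : ℝ) ≤
      ⌊L * C⌋₊ := by exact_mod_cast h5
  linarith

theorem sum_mul_gain_le (Y : I.Outcome) (m : ℕ) :
    (∑ i ∈ Finset.range m, if (stateAt Y i).Seed then
      (seedsAt Y i + 1) * (gain (ext Y) (stateAt Y i) / (stateAt Y i).need : ℝ) else 0) ≤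
    (harmonic I.k : ℝ) * seedsAt Y m := by
  have h1 := sum_gain_le (Y := ext Y) (k := I.k) I.wf m
  have h2 : (∑ i ∈ Finset.range m, if (stateAt Y i).Seed then
      (gain (ext Y) (stateAt Y i) / (stateAt Y i).need : ℝ) else 0) ≤ harmonic I.k := by
    have h1' := (Rat.cast_le (K := ℝ)).2 h1
    rw [Rat.cast_sum] at h1'
    refine le_trans (Finset.sum_le_sum fun i _ => ?_) h1'
    change (if (stateAt Y i).Seed then _ else _) ≤
      (((if (stateAt Y i).Seed then (gain (ext Y) (stateAt Y i) : ℚ) / (stateAt Y i).need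
        else 0) : ℚ) : ℝ)
    split <;> simp
  rw [mul_comm]
  refine le_trans ?_ (mul_le_mul_of_nonneg_left h2 (Nat.cast_nonneg _))
  rw [Finset.mul_sum]
  refine Finset.sum_le_sum fun i hi => ?_
  split
  · rename_i hs
    have h3 : seedsAt Y i + 1 ≤ seedsAt Y m := by
      have h4 := seeds_mono (ext Y) (start I.probList I.edgeList I.k)
        (Nat.succ_le_of_lt (Finset.mem_range.1 hi))
      rw [Nat.succ_eq_add_one, seeds_succ] at h4
      exact (congrArg (seedsAt Y i + ·) (if_pos hs)).symm.trans_le h4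
    have h5 : ((seedsAt Y i : ℝ) + 1) ≤ seedsAt Y m := by exact_mod_cast h3
    exact mul_le_mul_of_nonneg_right h5 (by positivity)
  · simp

/-- The expected number of seeds is at most `8 H_k` times the expected number of probes of any
feasible policy. -/
theorem expect_seeds_le {π : Policy I.Edge} (hπ : I.IsFeasible π) :
    I.expect (fun Y => (seedsAt Y I.edgeList.length : ℝ)) ≤
      8 * harmonic I.k * I.expectedCost π := by
  classical
  set H : ℝ := ((harmonic I.k : ℚ) : ℝ) with hH
  have hH1 : 1 ≤ H := by
    have h1 := harmonic_mono I.one_le_k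
    have h2 : (harmonic 1 : ℚ) = 1 := by simp [harmonic]
    rw [h2] at h1
    rw [hH]
    exact_mod_cast h1
  set M := I.edgeList.length
  -- the slowdown of `π`
  set L : ℝ := 4 * H with hLdef
  have hL : 1 ≤ L := by linarith
  have h1 : I.expect (fun Y => (seedsAt Y M : ℝ)) ≤ L * I.expectedCost π +
      ∑ i ∈ Finset.range M, I.expect (fun Y => if (stateAt Y i).Seed ∧
        Finds π ⌊((seedsAt Y i : ℝ) + 1) / L⌋₊ Y then 1 else 0) := by
    rw [expectedCost, ← expect_const_mul, ← expect_sum, ← expect_add]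
    refine expect_mono fun Y => ?_
    have := seeds_sub_le hL Y (hπ Y)
    linarith
  have h2 : L / 2 * ∑ i ∈ Finset.range M, I.expect (fun Y => if (stateAt Y i).Seed ∧
        Finds π ⌊((seedsAt Y i : ℝ) + 1) / L⌋₊ Y then 1 else 0) ≤
      H * I.expect (fun Y => (seedsAt Y M : ℝ)) := by
    rw [Finset.mul_sum]
    refine (Finset.sum_le_sum fun i _ => half_mul_expect_finds_le π (by linarith) i).trans ?_
    rw [← expect_sum, ← expect_const_mul]
    exact expect_mono fun Y => sum_mul_gain_le Y M
  set A := I.expect (fun Y => (seedsAt Y M : ℝ))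
  set S := ∑ i ∈ Finset.range M, I.expect (fun Y => if (stateAt Y i).Seed ∧
        Finds π ⌊((seedsAt Y i : ℝ) + 1) / L⌋₊ Y then 1 else 0)
  set O := I.expectedCost π
  have h3 : H * A ≤ H * (8 * H * O) := by
    have h4 := mul_le_mul_of_nonneg_left h1 (show 0 ≤ L / 2 by linarith)
    rw [hLdef] at h2 h4
    nlinarith
  exact le_of_mul_le_mul_left h3 (by linarith)

/-! ### The algorithm -/

/-- The probes of the algorithm. -/
noncomputable def algProbes (Y : I.Outcome) : List I.Edge :=
  ((start I.probList I.edgeList I.k).probeList (edgeState (ext Y)) I.edgeList.length).map I.toEdge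

/-- Whatever the algorithm has recorded has been probed. -/
theorem mem_probeList_of_mem_run {Y : ℕ → Bool} {e : ℕ × ℕ} (m : ℕ) (s : State)
    (h : e ∈ (run Y s m).active ∨ e ∈ (run Y s m).inactive) :
    e ∈ s.probeList (edgeState Y) m ∨ e ∈ s.active ∨ e ∈ s.inactive := by
  induction m generalizing s with
  | zero => exact Or.inr h
  | succ m ih =>
    rw [State.probeList]
    have hsucc : run Y s (m + 1) = run Y (s.next (edgeState Y)) m := rfl
    rw [hsucc] at h
    split
    · rename_i hr
      have h1 := ih _ h
      cases hX : edgeState Y s.pick.1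
      · rw [State.next_of_inactive hr hX] at h1 ⊢
        simp only [List.mem_cons] at h1 ⊢
        tauto
      · rw [State.next_of_active hr hX] at h1 ⊢
        simp only [List.mem_cons] at h1 ⊢
        tauto
    · rename_i hr
      rw [State.next_of_not_running hr] at h
      exact (ih s h).imp_left fun h' => by
        cases m with
        | zero => exact h'
        | succ m => rwa [State.probeList, if_neg hr] at h'

theorem length_unprobed_run {Y : ℕ → Bool} {s : State} {i : ℕ} (h : (run Y s i).Running) :
    (run Y s i).unprobed.length + i = s.unprobed.length := by
  induction i with
  | zero => rfl
  | succ i ih =>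
    have hr : (run Y s i).Running := by
      by_contra hr
      rw [not_running_run i.le_succ hr] at h
      exact hr h
    have h1 := ih hr
    have h2 := State.length_unprobed_next (X := edgeState Y) hr
    rw [run_succ]
    omega

theorem done_algProbes (Y : I.Outcome) : I.Done Y (algProbes Y) := by
  classical
  have hreach := reachable Y I.edgeList.length
  have hmem : ∀ e, e ∈ (stateAt Y I.edgeList.length).active ∨
      e ∈ (stateAt Y I.edgeList.length).inactive → I.toEdge e ∈ algProbes Y := by
    intro e he
    refine List.mem_map_of_mem ?_
    simpa [start] using mem_probeList_of_mem_run I.edgeList.length _ he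
  have hdone : ¬ (stateAt Y I.edgeList.length).Running := by
    intro h
    have h1 := length_unprobed_run h
    have h2 : (start I.probList I.edgeList I.k).unprobed.length = I.edgeList.length := rfl
    exact h.1 (List.length_eq_zero_iff.1 (by unfold stateAt; omega))
  generalize stateAt Y I.edgeList.length = s at *
  have hnd := List.nodup_append.1 (hreach.perm.nodup_iff.2 I.wf.nodup)
  by_cases hneed : s.need = 0
  · left
    have h1 := hreach.need
    have hact : ∀ e ∈ s.active, e ∈ I.edgeList := fun e he =>
      hreach.perm.mem_iff.1 (by simp [he])
    have h2 : (s.active.toFinset.image I.toEdge).card = I.k := by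
      rw [Finset.card_image_of_injOn, List.toFinset_card_of_nodup (List.nodup_append.1 hnd.1).2.1]
      · omega
      · intro e he e' he' h
        simp only [List.coe_toFinset, Set.mem_ofPred_eq] at he he'
        exact toEdge_injOn (hact e he) (hact e' he') h
    rw [← h2, ← Set.ncard_coe_finset]
    refine Set.ncard_le_ncard fun f hf => ?_
    simp only [Finset.coe_image, List.coe_toFinset, Set.mem_image, Set.mem_ofPred_eq] at hf
    obtain ⟨e, he, rfl⟩ := hf
    exact ⟨hmem e (Or.inl he), by rw [X_toEdge Y (hact e he)]; exact hreach.active e he⟩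
  · right
    have hun : s.unprobed = [] := by
      by_contra h
      exact hdone ⟨h, hneed⟩
    intro f
    obtain ⟨e, he, rfl⟩ := exists_toEdge f
    have := hreach.perm.mem_iff.2 he
    rw [hun] at this
    simp only [List.nil_append, List.mem_append] at this
    exact hmem e this

theorem length_algProbes_le (Y : I.Outcome) :
    (algProbes Y).length ≤ seedsAt Y I.edgeList.length + 2 * (I.k - 1) := by
  rw [algProbes, List.length_map, length_probeList]
  exact sum_running_le I.wf _

/-- The constant `8` of `expect_seeds_le` suffices for all probes, because `H_k ≤ 1 + log k` and
`2 * (k - 1) / k ≤ 2 * log k`, while `10 * log k ≤ 8 * logb 2 k`. -/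
theorem expect_length_algProbes_le {π : Policy I.Edge} (hπ : I.IsFeasible π) :
    I.expect (fun Y => ((algProbes Y).length : ℝ)) ≤
      8 * (1 + Real.logb 2 (I.k : ℝ)) * I.expectedCost π := by
  have hk : (1 : ℝ) ≤ I.k := by exact_mod_cast I.one_le_k
  have hk0 : (0 : ℝ) < I.k := by linarith
  have h1 : I.expect (fun Y => ((algProbes Y).length : ℝ)) ≤
      I.expect (fun Y => (seedsAt Y I.edgeList.length : ℝ)) +
        2 * (1 - (I.k : ℝ)⁻¹) * I.expectedCost π := by
    rw [expectedCost, ← expect_const_mul, ← expect_add]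
    refine expect_mono fun Y => ?_
    have h2 : ((algProbes Y).length : ℝ) ≤
        (seedsAt Y I.edgeList.length : ℝ) + 2 * ((I.k - 1 : ℕ) : ℝ) := by
      exact_mod_cast length_algProbes_le Y
    rw [Nat.cast_sub I.one_le_k, Nat.cast_one] at h2
    have h3 : (I.k : ℝ) ≤ (π.probes (I.X Y)).length := by exact_mod_cast k_le_length (hπ Y)
    have h4 : (I.k : ℝ)⁻¹ ≤ 1 := inv_le_one_of_one_le₀ hk
    have h5 : (1 - (I.k : ℝ)⁻¹) * I.k = I.k - 1 := by
      rw [sub_mul, inv_mul_cancel₀ hk0.ne', one_mul]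
    have h6 := mul_le_mul_of_nonneg_left h3 (sub_nonneg.2 h4)
    linarith
  have h2 := expect_seeds_le hπ
  have h3 : (harmonic I.k : ℝ) ≤ 1 + Real.log I.k := harmonic_le_one_add_log I.k
  have h4 : 1 - (I.k : ℝ)⁻¹ ≤ Real.log I.k := Real.one_sub_inv_le_log_of_pos hk0
  have h5 : 0 ≤ Real.log I.k := Real.log_nonneg hk
  have h6 : 10 * Real.log I.k ≤ 8 * Real.logb 2 I.k := by
    rw [Real.logb, mul_div_assoc', le_div_iff₀ (Real.log_pos (by norm_num))]
    have := Real.log_two_lt_d9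
    nlinarith
  have h7 : 0 ≤ I.expectedCost π :=
    Finset.sum_nonneg fun Y _ => mul_nonneg (weight_nonneg Y) (Nat.cast_nonneg _)
  calc _ ≤ _ := h1
    _ ≤ (8 * harmonic I.k + 2 * (1 - (I.k : ℝ)⁻¹)) * I.expectedCost π := by linarith
    _ ≤ _ := mul_le_mul_of_nonneg_right (by linarith) h7

end Input

/-- One program runs the algorithm on all instances in polynomial time. -/
theorem exists_prog : ∃ (A : Prog) (T : ℕ[X]), ∀ (I : Input) (Y : I.Outcome),
    ∃ (out : Data) (t : ℕ),
      Exec (I.oracle Y) A I.encode out (Input.algProbes Y) t ∧ t ≤ T.eval I.encode.size := by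
  have hstart : PolyTime fun x : List (ℕ × ℕ) × List (ℕ × ℕ) × ℕ => start x.1 x.2.1 x.2.2 :=
    PolyTime.mk PolyTime.fst (PolyTime.fst.comp PolyTime.snd) (PolyTime.const [])
      (PolyTime.const []) (PolyTime.snd.comp PolyTime.snd)
  obtain ⟨A, T, hA⟩ := hstart
  obtain ⟨B, S, hB⟩ := exists_loop
  refine ⟨.seq A B, 1 + T + S.comp T, fun I Y => ?_⟩
  obtain ⟨t, ht, he⟩ := hA (I.probList, I.edgeList, I.k)
  obtain ⟨out, t', ht', he'⟩ := hB _ (I.oracle Y) (edgeState (Input.ext Y)) I.toEdge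
    (start I.probList I.edgeList I.k) fun e he => Input.oracle_enc Y he
  have h1 := he _ (I.oracle Y)
  refine ⟨out, 1 + t + t', ?_, ?_⟩
  · rw [Input.encode_eq]
    exact Exec.seq (l₁ := []) h1 he'
  · have h2 := eval_mono S (h1.size_le.trans ht)
    have h3 : I.encode.size = sz (I.probList, I.edgeList, I.k) := by rw [Input.encode_eq]; rfl
    rw [h3]
    simp only [eval_add, eval_one, eval_comp]
    exact Nat.add_le_add (Nat.add_le_add_left ht 1) (ht'.trans h2)

end GraphProbing

theorem theorem3 :
    ∃ (A : GraphProbing.Prog) (T : Polynomial ℕ), ∀ I : GraphProbing.Input,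
      ∃ probes : I.Outcome → List I.Edge,
        (∀ Y : I.Outcome,
          (∃ (out : GraphProbing.Data) (t : ℕ),
            GraphProbing.Exec (I.oracle Y) A I.encode out (probes Y) t ∧
              t ≤ T.eval I.encode.size) ∧
          I.Done Y (probes Y)) ∧
        ∀ π : GraphProbing.Policy I.Edge, I.IsFeasible π →
          I.expect (fun Y => ((probes Y).length : ℝ)) ≤
            8 * (1 + Real.logb 2 (I.k : ℝ)) * I.expectedCost π := by
  obtain ⟨A, T, h⟩ := GraphProbing.exists_prog
  exact ⟨A, T, fun I => ⟨GraphProbing.Input.algProbes,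
    fun Y => ⟨h I Y, GraphProbing.Input.done_algProbes Y⟩,
    fun π hπ => GraphProbing.Input.expect_length_algProbes_le hπ⟩⟩
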